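/- All graphs are finite and simple. For a graph $G$ and $X\subseteq V(G)$, the cut-rank $\rho_G(X)$ is the rank over $\mathbb F_2$ of the $X\times(V(G)\setminus X)$ submatrix of the adjacency matrix of $G$, and the average cut-rank of $G$ is $\mathbb E\rho(G)=2^{-|V(G)|}\sum_{X\subseteq V(G)}\rho_G(X)$. The local complementation of $G$ at a vertex $v$ is the graph on $V(G)$ obtained by switching adjacency and non-adjacency between every two distinct neighbors of $v$. A graph $H$ is a vertex-minor of $G$ if $H$ is an induced subgraph of a graph that can be obtained from $G$ by a (possibly empty) finite sequence of local complementations. Let $P_n$ be the path on $n$ vertices, $K_n$ the complete graph on $n$ vertices and $K_{1,n}$ the star with $n$ leaves; let $G+H$ be the disjoint union of $G$ and $H$, and $mG$ the disjoint union of $m$ copies of $G$. For $k\ge 0$, let $E_k$ be $K_{1,k+1}$ with one edge subdivided once. **Theorem 1.5.** Let $G$ be a graph with no isolated vertices. Then $\mathbb E\rho(G)\le 3/2$ if and only if $G$ is isomorphic to a vertex-minor of one of the graphs $P_5$, $3K_2$, $2P_3$, $K_{1,k+1}$, $K_2+K_{1,k+1}$ and $E_k$, where $k$ ranges over all integers $k\ge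 0$. In addition, the set of all reals in $[0,3/2]$ that are the average cut-rank of some graph (with or without isolated vertices) is exactly $$\left\{1-\frac{1}{2^k}:k\ge0\right\}\cup\left\{\frac32-\frac1{2^{k+1}}:k\ge0\right\}\cup\left\{\frac32-\frac3{2^{k+2}}:k\ge0\right\}\cup\left\{\frac32\right\}.$$ -/

import Mathlib

universe u

namespace SimpleGraph

/-- The cut-rank `ρ_G(X)`: the rank over the binary field of the submatrix of the adjacency matrix
of `G` with rows indexed by `X` and columns indexed by the complement of `X`. -/
noncomputable def cutRank {V : Type*} [Fintype V] (G : SimpleGraph V) (X : Finset V) : ℕ := by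
  classical
  exact ((G.adjMatrix (ZMod 2)).submatrix
    (fun i : {v : V // v ∈ X} => i.val) (fun j : {v : V // v ∉ X} => j.val)).rank

/-- The average cut-rank: the mean of `ρ_G(X)` over all subsets `X` of the vertex set. -/
noncomputable def averageCutRank {V : Type*} [Fintype V] (G : SimpleGraph V) : ℝ :=
  (∑ X : Finset V, (G.cutRank X : ℝ)) / 2 ^ Fintype.card V

/-- The local complementation `G * v`: two distinct vertices are adjacent in `G * v` iff
they are adjacent in `G` and at least one of them is not adjacent to `v`, or
they are nonadjacent in `G` and both are adjacent to `v`. -/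
def localComplement {V : Type*} (G : SimpleGraph V) (v : V) : SimpleGraph V where
  Adj x y := x ≠ y ∧
    ((G.Adj x y ∧ ¬ (G.Adj v x ∧ G.Adj v y)) ∨ (¬ G.Adj x y ∧ G.Adj v x ∧ G.Adj v y))
  symm := ⟨fun x y h => by
    rw [G.adj_comm y x]
    tauto⟩
  loopless := ⟨fun _ h => h.1 rfl⟩

/-- `G'` can be obtained from `G` by a finite sequence of local complementations. -/
def LocallyEquivalent {V : Type*} (G G' : SimpleGraph V) : Prop :=
  Relation.ReflTransGen (fun G₁ G₂ : SimpleGraph V => ∃ v, G₂ = G₁.localComplement v) G G'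

/-- `H` is isomorphic to a vertex-minor of `G`, that is, to an induced subgraph of a graph
obtained from `G` by a finite sequence of local complementations. -/
def IsoToVertexMinor {W V : Type*} (H : SimpleGraph W) (G : SimpleGraph V) : Prop :=
  ∃ G' : SimpleGraph V, G.LocallyEquivalent G' ∧ ∃ S : Set V, Nonempty (H ≃g G'.induce S)

/-- The disjoint union `mG` of `m` copies of `G`. -/
def copies {V : Type*} (m : ℕ) (G : SimpleGraph V) : SimpleGraph (Fin m × V) where
  Adj p q := p.1 = q.1 ∧ G.Adj p.2 q.2
  symm := ⟨fun _ _ h => ⟨h.1.symm, h.2.symm⟩⟩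
  loopless := ⟨fun _ h => G.irrefl h.2⟩

/-- The graph obtained from `G` by subdividing the edge `ab`: the edge `ab` is removed, and
the new vertex `none` is joined exactly to `a` and `b`. -/
def subdivideEdge {V : Type*} (G : SimpleGraph V) (a b : V) : SimpleGraph (Option V) where
  Adj
    | some x, some y => G.Adj x y ∧ s(x, y) ≠ s(a, b)
    | some x, none => x = a ∨ x = b
    | none, some y => y = a ∨ y = b
    | none, none => False
  symm := ⟨fun p q h => by
    rcases p with _ | x <;> rcases q with _ | y
    · exact h
    · exact h
    · exact h
    · exact ⟨h.1.symm, by rw [Sym2.eq_swap]; exact h.2⟩⟩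
  loopless := ⟨fun p h => by
    rcases p with _ | x
    · exact h
    · exact G.irrefl h.1⟩

/-- The star `K_{1,k}`. -/
abbrev starK (k : ℕ) : SimpleGraph (Fin 1 ⊕ Fin k) :=
  completeBipartiteGraph (Fin 1) (Fin k)

/-- The graph `E_k`: the star `K_{1,k+1}` with one edge subdivided. -/
def graphE (k : ℕ) : SimpleGraph (Option (Fin 1 ⊕ Fin (k + 1))) :=
  (starK (k + 1)).subdivideEdge (Sum.inl 0) (Sum.inr 0)

end SimpleGraph

/-! Local complementation at `v` acts on each cut matrix by adding the row (or column) of `v` to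
others, so it preserves every cut-rank, and passing to an induced subgraph cannot raise the average.
Hence the average cut-rank is monotone under vertex-minors; it is also additive over disjoint
unions. If `p` is a pendant vertex at `q`, conditioning on whether the cut separates them gives E(G)
= E(G-p)/2 + (1 + E(G-p-q))/2 (`averageCutRank_pendant`), which evaluates stars and the graphs E_k;
P_5 has the value 23/16 by computation. All listed graphs stay within 3/2, and their values realise
the claimed set.

For the converse, a connected graph is built up one vertex at a time (`Connected.hasConnectedForm`).
Delete a non-cut vertex `v`; local complementations of G-v lift to G, so G-v may be taken to be a
star, a subdivided star or P_5. Inspecting the neighbourhood of `v`, either G is again locally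
equivalent to such a graph, or it has an induced subgraph on five or six vertices with average above
3/2. These small cases are finite checks: graphs are coded by bits, and an executable Gaussian
elimination is proved to compute the rank.

For disconnected graphs, the only standard forms of value at most 1 are stars and 2K_2, and every
one is worth at least 1/2, so very few sums fit below 3/2 (`HasStandardForm.sum`). Isolated vertices
contribute nothing, so the same list gives the set of values. -/

namespace Matrix

/-! ### Linear algebra: support, block-diagonal rank, one pivot step. -/

/-- A matrix supported on the rows in the range of `f` and the columns in the range of `g` has the
same rank as the corresponding submatrix. -/
theorem rank_submatrix_of_support {K m n m₀ n₀ : Type*} [Field K] [Fintype m] [Fintype n]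
    [Fintype m₀] [Fintype n₀] (A : Matrix m n K) {f : m₀ → m} {g : n₀ → n}
    (hf : f.Injective) (hg : g.Injective) (hrow : ∀ i j, i ∉ Set.range f → A i j = 0)
    (hcol : ∀ i j, j ∉ Set.range g → A i j = 0) : (A.submatrix f g).rank = A.rank := by
  classical
  refine le_antisymm (rank_submatrix_le A f g) ?_
  -- Extension by zero is multiplication by 0/1 matrices on both sides, which cannot raise the rank.
  have key : A = (1 : Matrix m m K).submatrix id f * A.submatrix f g *
      (1 : Matrix n n K).submatrix g id := by
    ext i j
    rw [mul_apply]
    simp only [mul_apply, submatrix_apply, id, one_apply]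
    by_cases hj : j ∈ Set.range g
    · obtain ⟨j, rfl⟩ := hj
      simp only [hg.eq_iff, mul_ite, mul_one, mul_zero, Finset.sum_ite_eq', Finset.mem_univ,
        if_true]
      by_cases hi : i ∈ Set.range f
      · obtain ⟨i, rfl⟩ := hi
        simp [hf.eq_iff]
      · rw [hrow _ _ hi]
        refine (Finset.sum_eq_zero fun x _ => ?_).symm
        rw [if_neg fun h => hi ⟨x, h.symm⟩, zero_mul]
    · rw [hcol _ _ hj]
      refine (Finset.sum_eq_zero fun x _ => ?_).symm
      rw [if_neg fun h => hj ⟨x, h⟩, mul_zero]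
  conv_lhs => rw [key]
  exact (rank_mul_le_left _ _).trans (rank_mul_le_right _ _)

theorem rank_fromBlocks_zero_zero {K m n m₀ n₀ : Type*} [Field K] [Fintype m] [Fintype n]
    [Fintype m₀] [Fintype n₀] (A : Matrix m n K) (D : Matrix m₀ n₀ K) :
    (fromBlocks A 0 0 D).rank = A.rank + D.rank := by
  have h : (fromBlocks A 0 0 D).mulVecLin =
      (LinearEquiv.sumArrowLequivProdArrow m m₀ K K).symm.toLinearMap ∘ₗ
        (A.mulVecLin.prodMap D.mulVecLin) ∘ₗ
          (LinearEquiv.sumArrowLequivProdArrow n n₀ K K).toLinearMap := by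
    refine LinearMap.ext fun x => ?_
    ext i
    rcases i with i | i <;>
      simp [mulVec, dotProduct, LinearEquiv.sumArrowLequivProdArrow]
  rw [rank, h, LinearMap.range_comp, LinearMap.range_comp, LinearEquiv.range, Submodule.map_top,
    LinearEquiv.finrank_map_eq, LinearMap.range_prodMap, rank, rank,
    ← Module.finrank_prod]
  have hinj : Function.Injective ((LinearMap.range A.mulVecLin).subtype.prodMap
      (LinearMap.range D.mulVecLin).subtype) :=
    Subtype.val_injective.prodMap Subtype.val_injective
  rw [← LinearMap.finrank_range_of_inj hinj, LinearMap.range_prodMap, Submodule.range_subtype,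
    Submodule.range_subtype]

end Matrix

open Submodule Module in
/-- One step of Gaussian elimination, as a statement about spans. -/
theorem finrank_span_insert_pivot {K ι : Type*} [Field K] [Finite ι] {r : ι → K} {j : ι}
    (hr : r j = 1) (S : Set (ι → K)) (red : (ι → K) → ι → K)
    (hred : ∀ s ∈ S, red s = s - s j • r) :
    finrank K (span K (insert r S)) = finrank K (span K (red '' S)) + 1 := by
  have hle : span K (red '' S) ≤ LinearMap.ker (LinearMap.proj (R := K) (φ := fun _ : ι => K) j) := by
    rw [span_le]
    rintro _ ⟨s, hs, rfl⟩
    simp [hred s hs, hr]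
  have hnot : r ∉ span K (red '' S) := fun h => by
    have := hle h
    simp [hr] at this
  have : span K (insert r S) = span K (red '' S) ⊔ span K {r} := by
    apply le_antisymm
    · rw [span_le]
      rintro x (rfl | hx)
      · exact mem_sup_right (mem_span_singleton_self _)
      · have : x = red x + x j • r := by rw [hred x hx]; abel
        rw [this]
        exact add_mem (mem_sup_left (subset_span ⟨x, hx, rfl⟩))
          (mem_sup_right (smul_mem _ _ (mem_span_singleton_self _)))
    · rw [sup_le_iff, span_le, span_singleton_le_iff_mem]
      refine ⟨?_, subset_span (Set.mem_insert _ _)⟩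
      rintro _ ⟨s, hs, rfl⟩
      rw [SetLike.mem_coe, hred s hs]
      exact sub_mem (subset_span (Set.mem_insert_of_mem _ hs))
        (smul_mem _ _ (subset_span (Set.mem_insert _ _)))
  rw [← finrank_sup_span_singleton hnot, this]

/-! ### Cut matrices and invariance of the cut-rank under local complementation. -/

namespace SimpleGraph

variable {V W : Type*}

open Classical in
/-- The adjacency matrix of `G` with all entries outside `X × Xᶜ` set to zero. -/
noncomputable def cutMatrix (G : SimpleGraph V) (X : Finset V) : Matrix V V (ZMod 2) :=
  Matrix.of fun i j => if i ∈ X ∧ j ∉ X ∧ G.Adj i j then 1 else 0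

open Classical in
theorem cutMatrix_apply (G : SimpleGraph V) (X : Finset V) (i j : V) :
    G.cutMatrix X i j = if i ∈ X ∧ j ∉ X ∧ G.Adj i j then 1 else 0 := rfl

/-- Padding with zeros makes the index types independent of `X`, so different cuts can be compared
by operations on square matrices over `V`. -/
theorem cutRank_eq [Fintype V] (G : SimpleGraph V) (X : Finset V) :
    G.cutRank X = (G.cutMatrix X).rank := by
  classical
  rw [cutRank, ← Matrix.rank_submatrix_of_support (G.cutMatrix X)
    (f := fun i : {v : V // v ∈ X} => i.val) (g := fun j : {v : V // v ∉ X} => j.val)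
    Subtype.val_injective Subtype.val_injective]
  · congr 1
    ext i j
    have := i.2
    have := j.2
    simp_all [cutMatrix_apply, adjMatrix_apply]
  · rintro i j h
    rw [cutMatrix_apply, if_neg]
    simp_all
  · rintro i j h
    rw [cutMatrix_apply, if_neg]
    simp_all

theorem cutRank_compl [Fintype V] [DecidableEq V] (G : SimpleGraph V) (X : Finset V) :
    G.cutRank Xᶜ = G.cutRank X := by
  rw [cutRank_eq, cutRank_eq, ← Matrix.rank_transpose]
  congr 1
  ext i j
  classical
  rw [Matrix.transpose_apply, cutMatrix_apply, cutMatrix_apply]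
  by_cases hi : i ∈ X <;> by_cases hj : j ∈ X <;> simp [hi, hj, G.adj_comm i j]

theorem cutRank_le_of_map [Fintype V] [Fintype W] (G : SimpleGraph V) (H : SimpleGraph W)
    (X : Finset V) (Y : Finset W) (f : W → V) (hf : ∀ a, f a ∈ X ↔ a ∈ Y)
    (hadj : ∀ a b, a ∈ Y → b ∉ Y → (G.Adj (f a) (f b) ↔ H.Adj a b)) :
    H.cutRank Y ≤ G.cutRank X := by
  classical
  rw [cutRank_eq, cutRank_eq]
  have : H.cutMatrix Y = (G.cutMatrix X).submatrix f f := by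
    ext a b
    rw [Matrix.submatrix_apply, cutMatrix_apply, cutMatrix_apply]
    by_cases ha : a ∈ Y <;> by_cases hb : b ∈ Y <;> simp [ha, hb, hf, hadj]
  rw [this]
  exact Matrix.rank_submatrix_le _ _ _

theorem localComplement_adj (G : SimpleGraph V) (v x y : V) :
    (G.localComplement v).Adj x y ↔ x ≠ y ∧
      ((G.Adj x y ∧ ¬ (G.Adj v x ∧ G.Adj v y)) ∨ (¬ G.Adj x y ∧ G.Adj v x ∧ G.Adj v y)) :=
  Iff.rfl

theorem localComplement_localComplement (G : SimpleGraph V) (v : V) :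
    (G.localComplement v).localComplement v = G := by
  ext x y
  have h1 : ∀ z, G.Adj v z → v ≠ z := fun z h => h.ne
  have h2 : G.Adj x y → x ≠ y := fun h => h.ne
  have h3 := G.loopless.irrefl v
  have := h1 x
  have := h1 y
  simp only [localComplement_adj]
  tauto

/-- If `v` lies in the cut set, local complementation adds row `v` to the rows of its neighbours in
the set, which is left multiplication by a matrix. Otherwise pass to the complementary set. The
inequality suffices because local complementation is an involution. -/
theorem cutRank_localComplement_le [Fintype V] (G : SimpleGraph V) (v : V) (X : Finset V) :
    (G.localComplement v).cutRank X ≤ G.cutRank X := by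
  classical
  have main : ∀ Y : Finset V, v ∈ Y → (G.localComplement v).cutRank Y ≤ G.cutRank Y := by
    intro Y hv
    rw [cutRank_eq, cutRank_eq]
    have : (G.localComplement v).cutMatrix Y =
        (1 + Matrix.of fun i j => if i ∈ Y ∧ G.Adj v i ∧ j = v then 1 else 0) * G.cutMatrix Y := by
      ext i j
      rw [add_mul, one_mul, Matrix.add_apply, Matrix.mul_apply]
      have : ∀ k, (Matrix.of fun i j => if i ∈ Y ∧ G.Adj v i ∧ j = v then (1 : ZMod 2) else 0) i k *
          G.cutMatrix Y k j = if k = v then (if i ∈ Y ∧ G.Adj v i then 1 else 0) *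
            G.cutMatrix Y v j else 0 := by
        intro k
        by_cases hk : k = v
        · subst hk; simp
        · simp [hk]
      rw [Finset.sum_congr rfl fun k _ => this k, Finset.sum_ite_eq' Finset.univ v]
      simp only [cutMatrix_apply, localComplement_adj, Finset.mem_univ, if_true, hv, true_and]
      have hij : i ∈ Y → j ∉ Y → i ≠ j := fun hi hj h => hj (h ▸ hi)
      by_cases hi : i ∈ Y <;> by_cases hj : j ∈ Y <;> by_cases h1 : G.Adj i j <;>
        by_cases h2 : G.Adj v i <;> by_cases h3 : G.Adj v j <;>
        simp [hi, hj, h1, h2, h3, hij]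
      decide
    rw [this]
    exact Matrix.rank_mul_le_right _ _
  by_cases hv : v ∈ X
  · exact main X hv
  · have := main Xᶜ (by simpa using hv)
    rwa [cutRank_compl, cutRank_compl] at this

theorem cutRank_localComplement [Fintype V] (G : SimpleGraph V) (v : V) (X : Finset V) :
    (G.localComplement v).cutRank X = G.cutRank X :=
  le_antisymm (cutRank_localComplement_le G v X) <| by
    have := cutRank_localComplement_le (G.localComplement v) v X
    rwa [localComplement_localComplement] at this

end SimpleGraph

/-! ### Average cut-rank: monotonicity, additivity and the pendant recursion. -/

namespace SimpleGraph

variable {V W : Type*}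

theorem averageCutRank_localComplement [Fintype V] (G : SimpleGraph V) (v : V) :
    (G.localComplement v).averageCutRank = G.averageCutRank := by
  simp only [averageCutRank, cutRank_localComplement]

theorem LocallyEquivalent.averageCutRank_eq [Fintype V] {G G' : SimpleGraph V}
    (h : G.LocallyEquivalent G') : G'.averageCutRank = G.averageCutRank := by
  induction h with
  | refl => rfl
  | tail _ h ih =>
    obtain ⟨v, rfl⟩ := h
    rw [averageCutRank_localComplement, ih]

theorem sum_finset_sum {M : Type*} [AddCommMonoid M] [Fintype V] [Fintype W]
    (g : Finset (V ⊕ W) → M) :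
    ∑ X, g X = ∑ Y : Finset V, ∑ Z : Finset W, g (Y.disjSum Z) := by
  calc ∑ X, g X = ∑ p : Finset V × Finset W, g (p.1.disjSum p.2) :=
        Fintype.sum_equiv Finset.sumEquiv.toEquiv _ _
          fun X => congrArg g (Finset.sumEquiv.symm_apply_apply X).symm
    _ = _ := Fintype.sum_prod_type _

theorem sum_finset_option {M : Type*} [AddCommMonoid M] [Fintype W] (g : Finset (Option W) → M) :
    ∑ X, g X = ∑ Y : Finset W, (g (Y.map Function.Embedding.some) + g (Finset.insertNone Y)) := by
  classical
  rw [Finset.sum_add_distrib]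
  let e : Finset W ⊕ Finset W ≃ Finset (Option W) :=
    { toFun := Sum.elim (fun Y => Y.map Function.Embedding.some) fun Y => Finset.insertNone Y
      invFun := fun X => if none ∈ X then Sum.inr X.eraseNone else Sum.inl X.eraseNone
      left_inv := by rintro (Y | Y) <;> simp
      right_inv := by
        intro X
        by_cases h : none ∈ X <;> simp [h] }
  rw [← Equiv.sum_comp e, Fintype.sum_sum_type]
  rfl

/-- Each subset of `W` is the trace of equally many subsets of `V`, so means over the two power sets
agree. This compares averages with different denominators. -/
theorem sum_preimage_div_two_pow [Fintype V] [Fintype W] {f : W → V} (hf : f.Injective)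
    (g : Finset W → ℝ) :
    (∑ X : Finset V, g (X.preimage f hf.injOn)) / 2 ^ Fintype.card V =
      (∑ Y, g Y) / 2 ^ Fintype.card W := by
  classical
  let e : W ⊕ {v // v ∉ Set.range f} ≃ V :=
    (Equiv.sumCongr (Equiv.ofInjective f hf) (Equiv.refl _)).trans (Equiv.Set.sumCompl (Set.range f))
  have he : ∀ w, e (Sum.inl w) = f w := fun w => rfl
  rw [← Fintype.sum_equiv (Equiv.finsetCongr e) (fun X => g ((X.map e.toEmbedding).preimage f hf.injOn))
    _ (fun X => rfl), sum_finset_sum, ← Fintype.card_congr e, Fintype.card_sum]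
  have key : ∀ (Y : Finset W) (Z : Finset {v // v ∉ Set.range f}),
      ((Y.disjSum Z).map e.toEmbedding).preimage f hf.injOn = Y := by
    intro Y Z
    ext w
    rw [Finset.mem_preimage, ← he, Finset.mem_map_equiv, Equiv.symm_apply_apply, Finset.inl_mem_disjSum]
  simp only [key, Finset.sum_const, Finset.card_univ, Fintype.card_finset, nsmul_eq_mul,
    ← Finset.mul_sum, pow_add, Nat.cast_pow, Nat.cast_ofNat]
  field_simp

theorem averageCutRank_le_of_injective [Fintype V] [Fintype W] (G : SimpleGraph V)
    (H : SimpleGraph W) {f : W → V} (hf : f.Injective)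
    (hadj : ∀ a b, G.Adj (f a) (f b) ↔ H.Adj a b) : H.averageCutRank ≤ G.averageCutRank := by
  rw [averageCutRank, averageCutRank, ← sum_preimage_div_two_pow hf]
  gcongr with X
  exact_mod_cast cutRank_le_of_map G H X _ f (by simp) fun a b _ _ => hadj a b

theorem averageCutRank_le_of_embedding [Fintype V] [Fintype W] {G : SimpleGraph V}
    {H : SimpleGraph W} (f : H ↪g G) : H.averageCutRank ≤ G.averageCutRank :=
  averageCutRank_le_of_injective G H f.injective fun _ _ => f.map_rel_iff

theorem averageCutRank_eq_of_iso [Fintype V] [Fintype W] {G : SimpleGraph V}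
    {H : SimpleGraph W} (f : G ≃g H) : G.averageCutRank = H.averageCutRank :=
  le_antisymm (averageCutRank_le_of_embedding f.toEmbedding)
    (averageCutRank_le_of_embedding f.symm.toEmbedding)

theorem cutRank_sum [Fintype V] [Fintype W] (G : SimpleGraph V) (H : SimpleGraph W)
    (Y : Finset V) (Z : Finset W) :
    (G ⊕g H).cutRank (Y.disjSum Z) = G.cutRank Y + H.cutRank Z := by
  classical
  rw [cutRank_eq, cutRank_eq, cutRank_eq, ← Matrix.rank_fromBlocks_zero_zero]
  congr 1
  ext i j
  rcases i with i | i <;> rcases j with j | j <;> simp [cutMatrix_apply]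

theorem averageCutRank_sum [Fintype V] [Fintype W] (G : SimpleGraph V) (H : SimpleGraph W) :
    (G ⊕g H).averageCutRank = G.averageCutRank + H.averageCutRank := by
  simp only [averageCutRank, sum_finset_sum, cutRank_sum, Fintype.card_sum, Nat.cast_add,
    Finset.sum_add_distrib, Finset.sum_const, Finset.card_univ, Fintype.card_finset, nsmul_eq_mul,
    ← Finset.mul_sum, pow_add, Nat.cast_pow, Nat.cast_ofNat]
  field_simp

theorem averageCutRank_bot [Fintype V] : (⊥ : SimpleGraph V).averageCutRank = 0 := by
  have : ∀ X, (⊥ : SimpleGraph V).cutRank X = 0 := by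
    intro X
    rw [cutRank_eq, ← Matrix.rank_zero (R := ZMod 2) (m := V) (n := V)]
    congr 1
    ext i j
    simp [cutMatrix_apply]
  simp [averageCutRank, this]

theorem averageCutRank_nonneg [Fintype V] (G : SimpleGraph V) : 0 ≤ G.averageCutRank := by
  unfold averageCutRank
  positivity

/-- The cut-rank of a cut separating a pendant vertex `none` from its neighbour `some none`. -/
theorem cutRank_pendant [Fintype W] (G : SimpleGraph (Option (Option W)))
    (hG : ∀ x, G.Adj none x ↔ x = some none) (Y : Finset W) :
    G.cutRank (Finset.insertNone (Y.map Function.Embedding.some)) =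
      (G.comap fun w => some (some w)).cutRank Y + 1 := by
  classical
  set X : Finset (Option (Option W)) := Finset.insertNone (Y.map Function.Embedding.some) with hX
  have hX0 : none ∈ X := by simp [hX]
  have hX1 : some none ∉ X := by simp [hX]
  have hX2 : ∀ w, some (some w) ∈ X ↔ w ∈ Y := by simp [hX]
  -- Row `none` is the unit vector at `some none`, so eliminating with it clears that column and
  -- changes nothing else; what survives is the cut matrix of the graph without both vertices.
  let N : Matrix (Option W) (Option (Option W)) (ZMod 2) := Matrix.of fun i j =>
    G.cutMatrix X (some i) j - G.cutMatrix X (some i) (some none) * G.cutMatrix X none j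
  have hrow : ∀ x, G.cutMatrix X none x = if x = some none then 1 else 0 := by
    intro x
    rw [cutMatrix_apply]
    by_cases hx : x = some none <;> simp [hG, hX0, hX1, hx]
  have h1 : (G.cutMatrix X).rank = N.rank + 1 := by
    rw [Matrix.rank_eq_finrank_span_row, Matrix.rank_eq_finrank_span_row]
    have e1 : Set.range (G.cutMatrix X).row =
        insert (G.cutMatrix X none) (Set.range fun i => G.cutMatrix X (some i)) := by
      ext r
      rw [Set.mem_insert_iff, Set.mem_range, Set.mem_range, Option.exists, eq_comm (a := r)]
      rfl
    have e2 : Set.range N.row = (fun s => s - s (some none) • G.cutMatrix X none) ''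
        Set.range fun i => G.cutMatrix X (some i) := by
      rw [← Set.range_comp]
      rfl
    rw [e1, e2]
    exact finrank_span_insert_pivot (by rw [hrow, if_pos rfl]) _ _ fun _ _ => rfl
  rw [cutRank_eq, cutRank_eq, h1, ← Matrix.rank_submatrix_of_support N
    (f := fun w => some w) (g := fun w => some (some w))]
  · congr 2
    ext i j
    simp [N, hrow, cutMatrix_apply, hX2]
  · exact Option.some_injective _
  · exact (Option.some_injective _).comp (Option.some_injective _)
  · rintro (_ | i) j h
    · simp [N, cutMatrix_apply, hX1]
    · exact absurd ⟨i, rfl⟩ h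
  · rintro i (_ | _ | j) h
    · simp [N, cutMatrix_apply, hX0]
    · simp [N, hrow]
    · exact absurd ⟨j, rfl⟩ h

/-- The only edge at `none` does not cross the cut, so its row and column in the cut matrix vanish.
-/
theorem cutRank_pendant_same [Fintype W] (G : SimpleGraph (Option (Option W)))
    (hG : ∀ x, G.Adj none x ↔ x = some none) (X : Finset (Option (Option W)))
    (Z : Finset (Option W)) (hX : none ∈ X ↔ some none ∈ X) (hZ : ∀ w, some w ∈ X ↔ w ∈ Z) :
    G.cutRank X = (G.comap some).cutRank Z := by
  classical
  apply le_antisymm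
  · rw [cutRank_eq, cutRank_eq, ← Matrix.rank_submatrix_of_support (G.cutMatrix X)
      (f := some) (g := some) (Option.some_injective _) (Option.some_injective _)]
    · apply le_of_eq
      congr 1
      ext i j
      simp [cutMatrix_apply, hZ]
    · rintro (_ | i) j h
      · rw [cutMatrix_apply, if_neg]
        rw [hG]
        rintro ⟨h1, h2, rfl⟩
        exact h2 (hX.1 h1)
      · exact absurd ⟨i, rfl⟩ h
    · rintro i (_ | j) h
      · rw [cutMatrix_apply, if_neg]
        rw [G.adj_comm, hG]
        rintro ⟨h1, h2, rfl⟩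
        exact h2 (hX.2 h1)
      · exact absurd ⟨j, rfl⟩ h
  · exact cutRank_le_of_map G _ X Z some hZ fun _ _ _ _ => Iff.rfl

/-- Half of all cuts keep `none` with its neighbour, and there `none` can be deleted. The other half
separate them: the pendant edge contributes 1 and both vertices can be deleted. -/
theorem averageCutRank_pendant [Fintype W] (G : SimpleGraph (Option (Option W)))
    (hG : ∀ x, G.Adj none x ↔ x = some none) :
    G.averageCutRank = (G.comap some).averageCutRank / 2 +
      (1 + (G.comap fun w : W => some (some w)).averageCutRank) / 2 := by
  classical
  have h1 : ∀ Y : Finset W, G.cutRank (Finset.insertNone (Y.map Function.Embedding.some)) =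
      (G.comap fun w => some (some w)).cutRank Y + 1 := cutRank_pendant G hG
  have h2 : ∀ Y : Finset W, G.cutRank ((Finset.insertNone Y).map Function.Embedding.some) =
      (G.comap fun w => some (some w)).cutRank Y + 1 := by
    intro Y
    rw [← cutRank_compl, ← cutRank_compl (G.comap _), ← h1]
    congr 1
    ext x
    rcases x with _ | _ | x <;> simp
  have h3 : ∀ Y : Finset W, G.cutRank ((Y.map Function.Embedding.some).map Function.Embedding.some) =
      (G.comap some).cutRank (Y.map Function.Embedding.some) := fun Y =>
    cutRank_pendant_same G hG _ _ (by simp) (by simp)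
  have h4 : ∀ Y : Finset W, G.cutRank (Finset.insertNone (Finset.insertNone Y)) =
      (G.comap some).cutRank (Finset.insertNone Y) := fun Y =>
    cutRank_pendant_same G hG _ _ (by simp) (by simp)
  simp only [averageCutRank, sum_finset_option, h1, h2, h3, h4, Nat.cast_add, Nat.cast_one,
    Finset.sum_add_distrib, Fintype.card_option, pow_succ, Finset.sum_const, Finset.card_univ,
    Fintype.card_finset, nsmul_eq_mul, Nat.cast_pow, Nat.cast_ofNat]
  field_simp
  ring

end SimpleGraph

/-! ### Executable cut-ranks of small graphs coded by bits. -/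

namespace SimpleGraph

variable {V W : Type*}

/-- Clear the leading bit of `r` in `s`, working over the binary field. -/
def reduceBits (r s : ℕ) : ℕ := if s.testBit r.log2 then s ^^^ r else s

/-- Gaussian elimination over the binary field, rows being encoded by their bits. -/
def bitRank : ℕ → List ℕ → ℕ
  | 0, _ => 0
  | _ + 1, [] => 0
  | k + 1, r :: L => if r = 0 then bitRank k L else bitRank k (L.map (reduceBits r)) + 1

/-- The rows of the cut matrix of the cut with characteristic bits `x`. -/
def cutBits (n : ℕ) (rows : List ℕ) (x : ℕ) : List ℕ :=
  (List.range n).map fun i => if x.testBit i then rows.getD i 0 &&& (2 ^ n - 1 - x) else 0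

/-- The sum of all cut-ranks of the graph on `n` vertices with the given adjacency bits. -/
def cutRankSum (n : ℕ) (rows : List ℕ) : ℕ :=
  ((List.range (2 ^ n)).map fun x => bitRank n (cutBits n rows x)).sum

/-- The vector over the binary field encoded by the bits of `r`. -/
def bitVector (n r : ℕ) : Fin n → ZMod 2 := fun j => if r.testBit j then 1 else 0

theorem testBit_log2 {r : ℕ} (hr : r ≠ 0) : r.testBit r.log2 = true := by
  have h1 : 2 ^ r.log2 ≤ r := Nat.log2_self_le hr
  have h2 : r < 2 ^ (r.log2 + 1) := Nat.lt_log2_self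
  rw [Nat.testBit_eq_decide_div_mod_eq, decide_eq_true_iff]
  have : r / 2 ^ r.log2 = 1 := by
    apply Nat.div_eq_of_lt_le <;> rw [pow_succ] at * <;> omega
  rw [this]

theorem bitVector_reduceBits (n : ℕ) {r : ℕ} (hr : r ≠ 0) (hn : r < 2 ^ n) (s : ℕ) :
    bitVector n (reduceBits r s) = bitVector n s -
      bitVector n s ⟨r.log2, (Nat.log2_lt hr).2 hn⟩ • bitVector n r := by
  ext j
  simp only [bitVector, reduceBits, Pi.sub_apply, Pi.smul_apply, smul_eq_mul]
  by_cases h : s.testBit r.log2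
  · simp only [h, if_true, Nat.testBit_xor, one_mul]
    cases s.testBit j <;> cases r.testBit j <;> decide
  · simp [h]

/-- The first argument of `bitRank` is fuel. Each step consumes one row, either a zero row or a
pivot at its leading bit, so the number of rows is enough. -/
theorem bitRank_eq_finrank (n k : ℕ) (L : List ℕ) (hk : L.length ≤ k) (hL : ∀ r ∈ L, r < 2 ^ n) :
    bitRank k L = Module.finrank (ZMod 2) (Submodule.span (ZMod 2) (bitVector n '' {r | r ∈ L})) := by
  induction k generalizing L with
  | zero =>
    obtain rfl : L = [] := List.length_eq_zero_iff.1 (by omega)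
    have : {r : ℕ | r ∈ ([] : List ℕ)} = ∅ := by ext; simp
    rw [this, Set.image_empty, Submodule.span_empty, finrank_bot]
    rfl
  | succ k ih =>
    rcases L with _ | ⟨r, L⟩
    · have : {r : ℕ | r ∈ ([] : List ℕ)} = ∅ := by ext; simp
      rw [this, Set.image_empty, Submodule.span_empty, finrank_bot]
      rfl
    have hset : bitVector n '' {s | s ∈ r :: L} =
        insert (bitVector n r) (bitVector n '' {s | s ∈ L}) := by
      rw [← Set.image_insert_eq]
      congr 1
      ext s
      simp
    simp only [List.length_cons, add_le_add_iff_right, List.mem_cons, forall_eq_or_imp] at hk hL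
    rw [hset, bitRank]
    split_ifs with h0
    · subst h0
      have : bitVector n 0 = 0 := by ext j; simp [bitVector]
      rw [ih L hk hL.2, this, Submodule.span_insert_zero]
    · have hlog : r.log2 < n := (Nat.log2_lt h0).2 hL.1
      rw [finrank_span_insert_pivot (j := ⟨r.log2, hlog⟩)
        (red := fun s => s - s ⟨r.log2, hlog⟩ • bitVector n r) (by simp [bitVector, testBit_log2 h0])
        _ (fun _ _ => rfl), ih (L.map (reduceBits r)) (by simpa using hk), ← Set.image_comp]
      · have : bitVector n '' {s | s ∈ L.map (reduceBits r)} =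
            (bitVector n ∘ reduceBits r) '' {s | s ∈ L} := by
          rw [Set.image_comp]
          congr 1
          ext s
          simp
        have hred : bitVector n ∘ reduceBits r =
            (fun s => s - s ⟨r.log2, hlog⟩ • bitVector n r) ∘ bitVector n :=
          funext fun s => bitVector_reduceBits n h0 hL.1 s
        rw [this, hred]
      · simp only [List.mem_map, forall_exists_index, and_imp, forall_apply_eq_imp_iff₂]
        intro s hs
        unfold reduceBits
        split_ifs
        · exact Nat.xor_lt_two_pow (hL.2 s hs) hL.1
        · exact hL.2 s hs

theorem bijective_bits (n : ℕ) :
    Function.Bijective fun x : Fin (2 ^ n) => Finset.univ.filter fun i : Fin n => x.val.testBit i := by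
  rw [Fintype.bijective_iff_injective_and_card]
  refine ⟨fun x y h => Fin.ext <| Nat.eq_of_testBit_eq fun i => ?_, by simp⟩
  by_cases hi : i < n
  · have := congrArg (fun S => (⟨i, hi⟩ : Fin n) ∈ S) h
    simpa using this
  · have hp : 2 ^ n ≤ 2 ^ i := Nat.pow_le_pow_right (by norm_num) (by omega)
    rw [Nat.testBit_lt_two_pow (x.2.trans_le hp), Nat.testBit_lt_two_pow (y.2.trans_le hp)]

/-- Turns the unknown neighbourhood of an added vertex into a number below `2 ^ n`, so that a finite
check over `N` covers all extensions. -/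
theorem exists_bits {n : ℕ} (p : Fin n → Prop) :
    ∃ N < 2 ^ n, ∀ i, p i ↔ N.testBit i = true := by
  classical
  obtain ⟨N, hN⟩ := (bijective_bits n).2 (Finset.univ.filter p)
  refine ⟨N, N.2, fun i => ?_⟩
  have := congrArg (fun S => i ∈ S) hN
  simpa using this.symm

/-- The vertices `f 0, …, f (n - 1)` induce the graph with the given adjacency bits. -/
def HasCode {n : ℕ} (G : SimpleGraph V) (f : Fin n → V) (rows : List ℕ) : Prop :=
  ∀ i j : Fin n, G.Adj (f i) (f j) ↔ (rows.getD i 0).testBit j = true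

theorem HasCode.sum_cutRank {n : ℕ} {G : SimpleGraph (Fin n)} {rows : List ℕ}
    (h : G.HasCode id rows) : ∑ X, G.cutRank X = cutRankSum n rows := by
  rw [← Fintype.sum_bijective _ (bijective_bits n) (fun x => bitRank n (cutBits n rows x.val)) _ ?_,
    cutRankSum, ← Finset.sum_range fun x => bitRank n (cutBits n rows x)]
  · rfl
  intro x
  rw [bitRank_eq_finrank n n _ (by simp [cutBits]), cutRank_eq, Matrix.rank_eq_finrank_span_row]
  · suffices bitVector n '' {r | r ∈ cutBits n rows x.val} = Set.range (G.cutMatrix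
        (Finset.univ.filter fun i : Fin n => x.val.testBit i)).row by rw [this]
    have : {r | r ∈ cutBits n rows x.val} = Set.range fun i : Fin n =>
        if x.val.testBit i then rows.getD i 0 &&& (2 ^ n - 1 - x.val) else 0 := by
      ext r
      simp [cutBits, Fin.exists_iff]
    rw [this, ← Set.range_comp]
    congr 1
    funext i j
    have hij := h i j
    simp only [id] at hij
    classical
    simp only [Function.comp_apply, Matrix.row, cutMatrix_apply, Finset.mem_filter,
      Finset.mem_univ, true_and, hij, bitVector]
    -- Subtraction from `2 ^ n - 1` flips the low `n` bits, so the mask selects the complement of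
    -- the cut set.
    have hj : (2 ^ n - 1 - x.val).testBit j = !x.val.testBit j := by
      have := Nat.testBit_two_pow_sub_succ x.2 j
      rw [Nat.sub_add_eq, Nat.sub_right_comm] at this
      simpa using this
    by_cases hi : x.val.testBit i <;> simp [hi, Nat.testBit_and, hj]
    by_cases hj' : x.val.testBit j <;> simp [hj']
  · simp only [cutBits, List.mem_map, forall_exists_index, and_imp, forall_apply_eq_imp_iff₂]
    intro i _
    split_ifs
    · have : 0 < 2 ^ n := by positivity
      exact lt_of_le_of_lt Nat.and_le_right (by omega)
    · positivity

theorem HasCode.averageCutRank_eq {n : ℕ} {G : SimpleGraph (Fin n)} {rows : List ℕ}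
    (h : G.HasCode id rows) : G.averageCutRank = cutRankSum n rows / 2 ^ n := by
  rw [averageCutRank, ← h.sum_cutRank, Fintype.card_fin]
  push_cast
  rfl

/-- An induced subgraph already exceeding 3/2 is an obstruction; the numerical hypothesis is that
inequality with denominators cleared. -/
theorem HasCode.lt_averageCutRank [Fintype V] {n : ℕ} {G : SimpleGraph V} {f : Fin n → V}
    {rows : List ℕ} (h : G.HasCode f rows) (hf : f.Injective)
    (hn : 3 * 2 ^ n < 2 * cutRankSum n rows) : 3 / 2 < G.averageCutRank := by
  refine lt_of_lt_of_le ?_ (averageCutRank_le_of_injective G (G.comap f) hf fun _ _ => Iff.rfl)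
  have hc : (G.comap f).HasCode id rows := h
  rw [hc.averageCutRank_eq, div_lt_div_iff₀ (by norm_num) (by positivity), mul_comm _ (2 : ℝ)]
  exact_mod_cast hn

/-- The adjacency bits after adding a vertex adjacent to the bits of `N`. -/
def extendCode (n : ℕ) (rows : List ℕ) (N : ℕ) : List ℕ :=
  ((List.range n).map fun i => rows.getD i 0 % 2 ^ n ||| (if N.testBit i then 2 ^ n else 0)) ++ [N]

theorem HasCode.extend {n : ℕ} {G : SimpleGraph V} {f : Fin n → V} {rows : List ℕ}
    (h : G.HasCode f rows) (v : V) {N : ℕ} (hN : N < 2 ^ n)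
    (hv : ∀ i, G.Adj v (f i) ↔ N.testBit i = true) :
    G.HasCode (Fin.snoc f v : Fin (n + 1) → V) (extendCode n rows N) := by
  intro i j
  have hlast : (extendCode n rows N).getD n 0 = N := by
    simp [extendCode, List.getD_eq_getElem?_getD]
  have hcast : ∀ i : Fin n, (extendCode n rows N).getD i 0 =
      rows.getD i 0 % 2 ^ n ||| (if N.testBit i then 2 ^ n else 0) := by
    intro i
    simp [extendCode, List.getD_eq_getElem?_getD]
  induction i using Fin.lastCases with
  | last =>
    simp only [Fin.val_last, hlast]
    induction j using Fin.lastCases with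
    | last => simp [Nat.testBit_lt_two_pow hN]
    | cast j => simp [hv]
  | cast i =>
    simp only [Fin.val_castSucc, hcast]
    induction j using Fin.lastCases with
    | last =>
      simp only [Fin.snoc_castSucc, Fin.snoc_last, G.adj_comm (f i), hv, Fin.val_last,
        Nat.testBit_or, Nat.testBit_mod_two_pow]
      cases N.testBit i <;> simp
    | cast j =>
      simp only [Fin.snoc_castSucc, h i j, Fin.val_castSucc, Nat.testBit_or,
        Nat.testBit_mod_two_pow]
      cases N.testBit i <;> simp [j.2.ne']

theorem snoc_injective {n : ℕ} {f : Fin n → V} (hf : f.Injective) {v : V} (hv : ∀ i, f i ≠ v) :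
    (Fin.snoc f v : Fin (n + 1) → V).Injective := by
  intro i j h
  induction i using Fin.lastCases <;> induction j using Fin.lastCases <;>
    simp_all [hf.eq_iff, eq_comm]

theorem HasCode.lt_averageCutRank_extend [Fintype V] {n : ℕ} {G : SimpleGraph V} {f : Fin n → V}
    {rows : List ℕ} (h : G.HasCode f rows) (hf : f.Injective) {v : V} (hvf : ∀ i, f i ≠ v)
    {N : ℕ} (hN : N < 2 ^ n) (hv : ∀ i, G.Adj v (f i) ↔ N.testBit i = true)
    (hn : 3 * 2 ^ (n + 1) < 2 * cutRankSum (n + 1) (extendCode n rows N)) :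
    3 / 2 < G.averageCutRank :=
  (h.extend v hN hv).lt_averageCutRank (snoc_injective hf hvf) hn

/-- The rows code P_5 with its vertices numbered along the path; `N ≠ 0` says that the sixth vertex
has a neighbour. -/
theorem cutRankSum_path_extend : ∀ N < 2 ^ 5, N ≠ 0 →
    3 * 2 ^ 6 < 2 * cutRankSum 6 (extendCode 5 [2, 5, 10, 20, 8] N) := by
  decide +kernel

theorem cutRankSum_path_eq : cutRankSum 5 [2, 5, 10, 20, 8] = 46 := by
  decide +kernel

end SimpleGraph

/-! ### Local equivalence and vertex-minors. -/

namespace SimpleGraph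

universe u₁ u₂

variable {V : Type u₁} {W : Type u₂}

namespace LocallyEquivalent

theorem refl (G : SimpleGraph V) : G.LocallyEquivalent G := Relation.ReflTransGen.refl

theorem trans {G₁ G₂ G₃ : SimpleGraph V} (h₁ : G₁.LocallyEquivalent G₂)
    (h₂ : G₂.LocallyEquivalent G₃) : G₁.LocallyEquivalent G₃ :=
  Relation.ReflTransGen.trans h₁ h₂

theorem localComplement {G G' : SimpleGraph V} (h : G.LocallyEquivalent G') (v : V) :
    G.LocallyEquivalent (G'.localComplement v) := Relation.ReflTransGen.tail h ⟨v, rfl⟩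

theorem symm {G G' : SimpleGraph V} (h : G.LocallyEquivalent G') : G'.LocallyEquivalent G := by
  induction h with
  | refl => exact refl G
  | @tail b _ _ h ih =>
    obtain ⟨v, rfl⟩ := h
    refine trans ?_ ih
    have := (refl (b.localComplement v)).localComplement v
    rwa [localComplement_localComplement] at this

theorem isIsolated_iff {G G' : SimpleGraph V} (h : G.LocallyEquivalent G') (w : V) :
    G'.IsIsolated w ↔ G.IsIsolated w := by
  have key : ∀ (H : SimpleGraph V) (v : V), H.IsIsolated w → (H.localComplement v).IsIsolated w := by
    intro H v hw x hx
    rw [localComplement_adj] at hx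
    rcases hx.2 with hx | hx
    · exact hw x hx.1
    · exact hw v hx.2.1.symm
  induction h with
  | refl => rfl
  | tail _ h ih =>
    obtain ⟨v, rfl⟩ := h
    refine Iff.trans ⟨fun h => ?_, key _ v⟩ ih
    have := key _ v h
    rwa [localComplement_localComplement] at this

/-- Local complementation at a vertex of `S` commutes with restriction to `S`. This permits
normalising G-v inside G. -/
theorem exists_of_induce {G : SimpleGraph V} {S : Set V} {K : SimpleGraph S}
    (h : (G.induce S).LocallyEquivalent K) :
    ∃ G', G.LocallyEquivalent G' ∧ G'.induce S = K := by
  induction h with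
  | refl => exact ⟨G, refl G, rfl⟩
  | tail _ h ih =>
    obtain ⟨v, rfl⟩ := h
    obtain ⟨G', h1, rfl⟩ := ih
    refine ⟨_, h1.localComplement v.val, ?_⟩
    ext x y
    simp [localComplement_adj, Subtype.ext_iff]

theorem exists_of_iso {G G' : SimpleGraph V} {H : SimpleGraph W} (e : G ≃g H)
    (h : G.LocallyEquivalent G') : ∃ H', H.LocallyEquivalent H' ∧ Nonempty (G' ≃g H') := by
  induction h with
  | refl => exact ⟨H, refl H, ⟨e⟩⟩
  | tail _ h ih =>
    obtain ⟨v, rfl⟩ := h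
    obtain ⟨H', h1, ⟨f⟩⟩ := ih
    refine ⟨_, h1.localComplement (f v), ⟨⟨f.toEquiv, ?_⟩⟩⟩
    intro x y
    simp [localComplement_adj, f.map_adj_iff]

theorem sum_left {G G' : SimpleGraph V} (h : G.LocallyEquivalent G') (H : SimpleGraph W) :
    (G ⊕g H).LocallyEquivalent (G' ⊕g H) := by
  induction h with
  | refl => exact refl _
  | tail _ h ih =>
    obtain ⟨v, rfl⟩ := h
    convert ih.localComplement (Sum.inl v) using 1
    ext (x | x) (y | y) <;> simp +contextual [localComplement_adj, H.ne_of_adj]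

theorem sum_right (G : SimpleGraph V) {H H' : SimpleGraph W} (h : H.LocallyEquivalent H') :
    (G ⊕g H).LocallyEquivalent (G ⊕g H') := by
  induction h with
  | refl => exact refl _
  | tail _ h ih =>
    obtain ⟨v, rfl⟩ := h
    convert ih.localComplement (Sum.inr v) using 1
    ext (x | x) (y | y) <;> simp +contextual [localComplement_adj, G.ne_of_adj]

end LocallyEquivalent

/-- `G` is locally equivalent to a graph isomorphic to `H`. -/
def LocallyEquivalentIso (G : SimpleGraph V) (H : SimpleGraph W) : Prop :=
  ∃ G', G.LocallyEquivalent G' ∧ Nonempty (G' ≃g H)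

namespace LocallyEquivalentIso

theorem averageCutRank_eq [Fintype V] [Fintype W] {G : SimpleGraph V} {H : SimpleGraph W}
    (h : G.LocallyEquivalentIso H) : G.averageCutRank = H.averageCutRank := by
  obtain ⟨G', h, ⟨e⟩⟩ := h
  rw [← averageCutRank_eq_of_iso e, h.averageCutRank_eq]

theorem isoToVertexMinor {G : SimpleGraph V} {H : SimpleGraph W}
    (h : G.LocallyEquivalentIso H) : G.IsoToVertexMinor H := by
  obtain ⟨G', h, ⟨e⟩⟩ := h
  obtain ⟨H', h', ⟨f⟩⟩ := h.symm.exists_of_iso e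
  exact ⟨H', h', Set.univ, ⟨f.trans (induceUnivIso H').symm⟩⟩

theorem of_iso {G : SimpleGraph V} {H : SimpleGraph W} (e : G ≃g H) : G.LocallyEquivalentIso H :=
  ⟨G, .refl G, ⟨e⟩⟩

theorem trans_iso {U : Type*} {G : SimpleGraph V} {H : SimpleGraph W} {K : SimpleGraph U}
    (h : G.LocallyEquivalentIso H) (e : H ≃g K) : G.LocallyEquivalentIso K := by
  obtain ⟨G', h, ⟨f⟩⟩ := h
  exact ⟨G', h, ⟨f.trans e⟩⟩

theorem iso_trans {U : Type*} {G : SimpleGraph V} {H : SimpleGraph W} {K : SimpleGraph U}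
    (e : G ≃g H) (h : H.LocallyEquivalentIso K) : G.LocallyEquivalentIso K := by
  obtain ⟨H', h, ⟨f⟩⟩ := h
  obtain ⟨G', h', ⟨g⟩⟩ := h.exists_of_iso e.symm
  exact ⟨G', h', ⟨g.symm.trans f⟩⟩

theorem sum {V' W' : Type*} {G : SimpleGraph V} {H : SimpleGraph W} {G' : SimpleGraph V'}
    {H' : SimpleGraph W'} (h : G.LocallyEquivalentIso H) (h' : G'.LocallyEquivalentIso H') :
    (G ⊕g G').LocallyEquivalentIso (H ⊕g H') := by
  obtain ⟨K, h, ⟨e⟩⟩ := h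
  obtain ⟨K', h', ⟨e'⟩⟩ := h'
  exact ⟨K ⊕g K', (h.sum_left G').trans (h'.sum_right K), ⟨Iso.sumCongr e e'⟩⟩

end LocallyEquivalentIso

theorem IsoToVertexMinor.averageCutRank_le [Fintype V] [Fintype W] {G : SimpleGraph V}
    {H : SimpleGraph W} (h : G.IsoToVertexMinor H) : G.averageCutRank ≤ H.averageCutRank := by
  obtain ⟨H', h, S, ⟨e⟩⟩ := h
  rw [← h.averageCutRank_eq]
  exact averageCutRank_le_of_embedding (e.toEmbedding.trans (Embedding.induce S))

/-- The adjacency bits of the local complementation at vertex `v`. -/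
def localComplementCode (n : ℕ) (rows : List ℕ) (v : ℕ) : List ℕ :=
  -- Adding row `v` to row `i` would create a loop at `i`; the summand `2 ^ i` removes it.
  (List.range n).map fun i => if (rows.getD v 0).testBit i then
    rows.getD i 0 ^^^ rows.getD v 0 ^^^ 2 ^ i else rows.getD i 0

theorem HasCode.localComplement {n : ℕ} {G : SimpleGraph V} {f : Fin n → V} {rows : List ℕ}
    (h : G.HasCode f rows) (hf : f.Injective) (v : Fin n) :
    (G.localComplement (f v)).HasCode f (localComplementCode n rows v) := by
  intro i j
  have hi : (localComplementCode n rows v).getD i 0 = if (rows.getD v 0).testBit i then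
      rows.getD i 0 ^^^ rows.getD v 0 ^^^ 2 ^ i.val else rows.getD i 0 := by
    simp [localComplementCode, List.getD_eq_getElem?_getD]
  have hne : G.Adj (f i) (f j) → i ≠ j := fun h e => h.ne (congrArg f e)
  have h1 := h i j
  have h2 := h v i
  have h3 := h v j
  rw [localComplement_adj, hi, hf.ne_iff]
  rw [h1] at hne
  rw [h1, h2, h3]
  by_cases c2 : (rows.getD v 0).testBit i
  · rw [if_pos c2, Nat.testBit_xor, Nat.testBit_xor, Nat.testBit_two_pow]
    by_cases hij : i = j
    · subst hij
      have c1 : (rows.getD i 0).testBit i = false := by simpa using hne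
      rw [c1, c2]
      simp
    · have : i.val ≠ j.val := fun h => hij (Fin.ext h)
      by_cases c1 : (rows.getD i 0).testBit j <;> by_cases c3 : (rows.getD v 0).testBit j <;>
        simp_all
  · rw [if_neg c2]
    simp
    tauto

theorem HasCode.foldl_localComplement {n : ℕ} {G : SimpleGraph V} {f : Fin n → V} {rows : List ℕ}
    (h : G.HasCode f rows) (hf : f.Injective) (l : List (Fin n)) :
    ∃ G', G.LocallyEquivalent G' ∧
      G'.HasCode f (l.foldl (fun r v => localComplementCode n r v) rows) := by
  induction l generalizing G rows with
  | nil => exact ⟨G, .refl G, h⟩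
  | cons v l ih =>
    obtain ⟨G', h1, h2⟩ := ih (h.localComplement hf v)
    exact ⟨G', ((LocallyEquivalent.refl G).localComplement (f v)).trans h1, h2⟩

end SimpleGraph

/-! ### Connected graphs, one vertex at a time. -/

namespace SimpleGraph

universe u₁

variable {V : Type u₁}

/-- `G` is a star. -/
def IsStar (G : SimpleGraph V) : Prop :=
  ∃ c, ∀ a b, G.Adj a b ↔ a ≠ b ∧ (a = c ∨ b = c)

/-- `G` is a star with one edge subdivided: `c` is the centre, and the vertex `x` subdivides
the edge from `c` to `y`. -/
def IsSubdividedStar (G : SimpleGraph V) : Prop :=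
  ∃ c x y, c ≠ x ∧ c ≠ y ∧ x ≠ y ∧ ∀ a b, G.Adj a b ↔ a ≠ b ∧
    ((a = c ∧ b ≠ y) ∨ (b = c ∧ a ≠ y) ∨ (a = x ∧ b = y) ∨ (a = y ∧ b = x))

/-- The standard forms of connected graphs of average cut-rank at most `3 / 2`. -/
def HasConnectedForm (G : SimpleGraph V) : Prop :=
  ∃ G', G.LocallyEquivalent G' ∧
    (G'.IsStar ∨ G'.IsSubdividedStar ∨ Nonempty (G' ≃g pathGraph 5))

theorem HasConnectedForm.of_locallyEquivalent {G G' : SimpleGraph V} (h : G.LocallyEquivalent G')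
    (h' : G'.HasConnectedForm) : G.HasConnectedForm := by
  obtain ⟨H, h1, h2⟩ := h'
  exact ⟨H, h.trans h1, h2⟩

theorem IsStar.hasConnectedForm {G : SimpleGraph V} (h : G.IsStar) : G.HasConnectedForm :=
  ⟨G, .refl G, Or.inl h⟩

theorem IsSubdividedStar.hasConnectedForm {G : SimpleGraph V} (h : G.IsSubdividedStar) :
    G.HasConnectedForm :=
  ⟨G, .refl G, Or.inr (Or.inl h)⟩

theorem HasCode.comp {m n : ℕ} {G : SimpleGraph V} {f : Fin n → V} {rows rows' : List ℕ}
    (h : G.HasCode f rows) (σ : Fin m → Fin n)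
    (hσ : ∀ i j : Fin m, (rows.getD (σ i) 0).testBit (σ j) = (rows'.getD i 0).testBit j) :
    G.HasCode (f ∘ σ) rows' := by
  intro i j
  rw [← hσ]
  exact h _ _

theorem pathGraph_five_hasCode : (pathGraph 5).HasCode id [2, 5, 10, 20, 8] := by
  intro i j
  simp only [id, pathGraph_adj]
  revert i j
  decide

theorem HasCode.nonempty_iso_path {G : SimpleGraph V} {f : Fin 5 → V}
    (h : G.HasCode f [2, 5, 10, 20, 8]) (hf : f.Bijective) : Nonempty (G ≃g pathGraph 5) :=
  ⟨Iso.symm ⟨Equiv.ofBijective f hf, fun {i j} =>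
    (h i j).trans (pathGraph_five_hasCode i j).symm⟩⟩

theorem HasCode.isSubdividedStar {G : SimpleGraph V} {f : Fin 5 → V}
    (h : G.HasCode f [14, 1, 1, 17, 8]) (hf : f.Bijective) : G.IsSubdividedStar := by
  refine ⟨f 0, f 3, f 4, hf.1.ne (by decide), hf.1.ne (by decide), hf.1.ne (by decide), ?_⟩
  intro a b
  obtain ⟨i, rfl⟩ := hf.2 a
  obtain ⟨j, rfl⟩ := hf.2 b
  rw [h i j]
  simp only [hf.1.eq_iff, ne_eq]
  revert i j
  decide

/-- The local complementations `p.1` turn the graph with adjacency bits `rows` into the graph with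
adjacency bits `rows'`, vertices being renumbered by `p.2`. -/
def Transforms (rows rows' : List ℕ) (p : List (Fin 5) × (Fin 5 → Fin 5)) : Prop :=
  p.2.Injective ∧ ∀ i j : Fin 5,
    ((p.1.foldl (fun r v => localComplementCode 5 r v) rows).getD (p.2 i) 0).testBit (p.2 j) =
      (rows'.getD i 0).testBit j

instance (rows rows' : List ℕ) (p : List (Fin 5) × (Fin 5 → Fin 5)) :
    Decidable (Transforms rows rows' p) := by
  unfold Transforms
  infer_instance

theorem HasCode.exists_of_transforms {G : SimpleGraph V} {f : Fin 5 → V} {rows rows' : List ℕ}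
    (h : G.HasCode f rows) (hf : f.Bijective) {p : List (Fin 5) × (Fin 5 → Fin 5)}
    (hp : Transforms rows rows' p) :
    ∃ G', G.LocallyEquivalent G' ∧ ∃ g : Fin 5 → V, g.Bijective ∧ G'.HasCode g rows' := by
  obtain ⟨G', h1, h2⟩ := h.foldl_localComplement hf.1 p.1
  exact ⟨G', h1, f ∘ p.2, hf.comp (Finite.injective_iff_bijective.1 hp.1), h2.comp p.2 hp.2⟩

theorem HasCode.hasConnectedForm_of_path {G : SimpleGraph V} {f : Fin 5 → V} {rows : List ℕ}
    (h : G.HasCode f rows) (hf : f.Bijective) {p : List (Fin 5) × (Fin 5 → Fin 5)}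
    (hp : Transforms rows [2, 5, 10, 20, 8] p) : G.HasConnectedForm := by
  obtain ⟨G', h1, g, hg, h2⟩ := h.exists_of_transforms hf hp
  exact ⟨G', h1, Or.inr (Or.inr (h2.nonempty_iso_path hg))⟩

theorem HasCode.hasConnectedForm_of_subdividedStar {G : SimpleGraph V} {f : Fin 5 → V}
    {rows : List ℕ} (h : G.HasCode f rows) (hf : f.Bijective)
    {p : List (Fin 5) × (Fin 5 → Fin 5)}
    (hp : Transforms rows [14, 1, 1, 17, 8] p) : G.HasConnectedForm := by
  obtain ⟨G', h1, g, hg, h2⟩ := h.exists_of_transforms hf hp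
  exact ⟨G', h1, Or.inr (Or.inl (h2.isSubdividedStar hg))⟩

/-- The rows code K_{1,4} with centre 0. The new vertex misses the centre and leaf 4 and sees leaves
1 and 2; leaf 3 is left free. -/
theorem cutRankSum_star_extend : ∀ N < 2 ^ 5, N.testBit 0 = false → N.testBit 1 = true →
    N.testBit 2 = true → N.testBit 4 = false →
    3 * 2 ^ 6 < 2 * cutRankSum 6 (extendCode 5 [30, 1, 1, 1, 1] N) := by
  decide +kernel

/-- The rows code E_2: centre 0, leaves 1 and 2, subdividing vertex 3, far end 4. The excluded `N =
1` attaches a further leaf to the centre. -/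
theorem cutRankSum_subdividedStar_extend : ∀ N < 2 ^ 5, N ≠ 0 → N ≠ 1 →
    3 * 2 ^ 6 < 2 * cutRankSum 6 (extendCode 5 [14, 1, 1, 17, 8] N) := by
  decide +kernel

/-- The rows code the path 1-0-2-3, which is E_1. Each attachment of a fifth vertex gives an
obstruction, E_2, or P_5; the lists hold witnessing local complementations and renumberings. -/
theorem path_four_extend : ∀ N < 2 ^ 4, N ≠ 0 →
    3 * 2 ^ 5 < 2 * cutRankSum 5 (extendCode 4 [6, 1, 9, 4] N) ∨
    (∃ p ∈ ([([], ![0, 1, 4, 2, 3]), ([], ![2, 3, 4, 0, 1])] :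
      List (List (Fin 5) × (Fin 5 → Fin 5))),
      Transforms (extendCode 4 [6, 1, 9, 4] N) [14, 1, 1, 17, 8] p) ∨
    (∃ p ∈ ([([], ![3, 2, 0, 1, 4]), ([1], ![3, 2, 0, 1, 4]), ([4], ![1, 0, 4, 2, 3]),
      ([0, 1, 0], ![3, 2, 1, 0, 4]), ([0, 1], ![3, 2, 1, 0, 4]), ([], ![1, 0, 2, 3, 4]),
      ([2, 3, 2], ![1, 0, 3, 2, 4]), ([3], ![1, 0, 2, 3, 4]), ([2, 3], ![1, 0, 3, 2, 4])] :
      List (List (Fin 5) × (Fin 5 → Fin 5))),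
      Transforms (extendCode 4 [6, 1, 9, 4] N) [2, 5, 10, 20, 8] p) := by
  decide +kernel

/-- A vertex joined to two of the three leaves of K_{1,3}: pivoting on its edge to leaf 1 yields
P_5. -/
theorem transforms_star_three_extend :
    Transforms (extendCode 4 [14, 1, 1, 1] 6) [2, 5, 10, 20, 8] ([1, 4, 1], ![2, 1, 4, 0, 3]) := by
  decide +kernel

theorem snoc_bijective {n : ℕ} {f : Fin n → V} (hf : f.Injective) {v : V} (hv : ∀ i, f i ≠ v)
    (hr : ∀ w, w ≠ v → ∃ i, f i = w) : (Fin.snoc f v : Fin (n + 1) → V).Bijective := by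
  refine ⟨snoc_injective hf hv, fun w => ?_⟩
  by_cases hw : w = v
  · exact ⟨Fin.last n, by simp [hw]⟩
  · obtain ⟨i, hi⟩ := hr w hw
    exact ⟨i.castSucc, by simp [hi]⟩

theorem injective_four {a b c d : V} (h : [a, b, c, d].Nodup) :
    Function.Injective ![a, b, c, d] :=
  List.nodup_ofFn.1 (by simpa using h)

theorem injective_five {a b c d e : V} (h : [a, b, c, d, e].Nodup) :
    Function.Injective ![a, b, c, d, e] :=
  List.nodup_ofFn.1 (by simpa using h)

theorem forall_four_ne {a b c d v : V} (h : v ∉ [a, b, c, d]) (i : Fin 4) : ![a, b, c, d] i ≠ v := by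
  rintro rfl
  fin_cases i <;> simp at h

theorem forall_five_ne {a b c d e v : V} (h : v ∉ [a, b, c, d, e]) (i : Fin 5) :
    ![a, b, c, d, e] i ≠ v := by
  rintro rfl
  fin_cases i <;> simp at h

/-- Adding a vertex `v` to a star with centre `c`. -/
theorem hasConnectedForm_of_star [Fintype V] {G : SimpleGraph V} {v c : V} (hcv : c ≠ v)
    (h : ∀ a b, a ≠ v → b ≠ v → (G.Adj a b ↔ a ≠ b ∧ (a = c ∨ b = c)))
    (hv : ∃ w, G.Adj v w) (havg : G.averageCutRank ≤ 3 / 2) : G.HasConnectedForm := by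
  by_cases hA : ∃ l, l ≠ c ∧ G.Adj v l
  swap
  · push Not at hA
    refine IsStar.hasConnectedForm ⟨c, ?_⟩
    have hvc : G.Adj v c := by
      obtain ⟨w, hw⟩ := hv
      by_contra hc
      exact hA w (by rintro rfl; exact hc hw) hw
    have key : ∀ b, G.Adj v b ↔ b = c := fun b =>
      ⟨fun hb => by_contra fun hbc => hA b hbc hb, fun hb => hb ▸ hvc⟩
    intro a b
    by_cases ha : a = v
    · subst ha
      rw [key]
      constructor
      · rintro rfl; exact ⟨hcv.symm, Or.inr rfl⟩
      · rintro ⟨_, h | h⟩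
        · exact absurd h hcv.symm
        · exact h
    · by_cases hb : b = v
      · subst hb
        rw [G.adj_comm, key]
        constructor
        · rintro rfl; exact ⟨ha, Or.inl rfl⟩
        · rintro ⟨_, h | h⟩
          · exact h
          · exact absurd h hcv.symm
      · exact h a b ha hb
  obtain ⟨l, hlc, hl⟩ := hA
  have hlv : l ≠ v := hl.ne'
  -- Local complementation at `l` only changes the adjacency of `c` and `v`.
  wlog hvc : ¬ G.Adj v c generalizing G
  · have hvc : G.Adj v c := by simpa using hvc
    have hla : ∀ a, a ≠ v → (G.Adj l a ↔ a = c) := fun a ha => by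
      rw [h l a hlv ha]
      constructor
      · rintro ⟨_, h | h⟩
        · exact absurd h hlc
        · exact h
      · rintro rfl; exact ⟨hlc, Or.inr rfl⟩
    refine HasConnectedForm.of_locallyEquivalent ((LocallyEquivalent.refl G).localComplement l) ?_
    apply this
    · intro a b ha hb
      rw [localComplement_adj, hla a ha, hla b hb, h a b ha hb]
      constructor
      · rintro ⟨hab, h | h⟩
        · exact h.1
        · exact absurd (h.2.1.trans h.2.2.symm) hab
      · rintro ⟨hab, h⟩
        exact ⟨hab, Or.inl ⟨⟨hab, h⟩, fun h => hab (h.1.trans h.2.symm)⟩⟩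
    · exact ⟨l, by rw [localComplement_adj]; simp [hl, hlv.symm]⟩
    · rwa [averageCutRank_localComplement]
    · rw [localComplement_adj]; simp [hl, hlv.symm]
    · rw [localComplement_adj]; simp [hvc, hl.symm, (hla c hcv).2 rfl]
  have hadj : ∀ a b, G.Adj a b ↔ a ≠ b ∧ ((a ≠ v ∧ b ≠ v ∧ (a = c ∨ b = c)) ∨
      (a = v ∧ G.Adj v b) ∨ (b = v ∧ G.Adj v a)) := by
    intro a b
    by_cases ha : a = v
    · subst ha
      have : G.Adj a b → a ≠ b := fun h => h.ne
      have := G.loopless.irrefl a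
      tauto
    · by_cases hb : b = v
      · subst hb
        have : G.Adj b a → a ≠ b := fun h => h.ne'
        rw [G.adj_comm]
        tauto
      · rw [h a b ha hb]
        tauto
  -- If `l` is the only neighbour of `v`, then `l` subdivides an edge from `c` to `v`.
  by_cases hA : ∃ l', l' ≠ l ∧ G.Adj v l'
  swap
  · push Not at hA
    refine IsSubdividedStar.hasConnectedForm ⟨c, l, v, hlc.symm, hcv, hlv, ?_⟩
    have key : ∀ b, G.Adj v b ↔ b = l := fun b =>
      ⟨fun hb => by_contra fun hbc => hA b hbc hb, fun hb => hb ▸ hl⟩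
    intro a b
    rw [hadj, key, key]
    grind
  obtain ⟨l', hl'l, hl'⟩ := hA
  have hl'c : l' ≠ c := by rintro rfl; exact hvc hl'
  have hl'v : l' ≠ v := hl'.ne'
  -- Here `v` sees two leaves. If it misses a leaf `b`, any further leaf gives a six-vertex
  -- obstruction, and otherwise G has just five vertices and becomes P_5.
  by_cases hB : ∃ b, b ≠ v ∧ b ≠ c ∧ ¬ G.Adj v b
  · obtain ⟨b, hbv, hbc, hb⟩ := hB
    have hbl : b ≠ l := by rintro rfl; exact hb hl
    have hbl' : b ≠ l' := by rintro rfl; exact hb hl'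
    by_cases hw : ∃ w, w ≠ v ∧ w ≠ c ∧ w ≠ l ∧ w ≠ l' ∧ w ≠ b
    · exfalso
      obtain ⟨w, hwv, hwc, hwl, hwl', hwb⟩ := hw
      let f : Fin 5 → V := ![c, l, l', w, b]
      have hf : f.Injective := injective_five (by grind)
      have hfv : ∀ i, f i ≠ v := forall_five_ne (by grind)
      have hcode : G.HasCode f [30, 1, 1, 1, 1] := by
        intro i j
        rw [h _ _ (hfv i) (hfv j), hf.ne_iff, show c = f 0 from rfl, hf.eq_iff, hf.eq_iff]
        revert i j
        decide
      obtain ⟨N, hN, hN'⟩ := exists_bits fun i => G.Adj v (f i)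
      refine absurd havg (not_le.2 (hcode.lt_averageCutRank_extend hf hfv hN hN'
        (cutRankSum_star_extend N hN ?_ ((hN' 1).1 hl) ((hN' 2).1 hl') ?_)))
      · exact Bool.eq_false_iff.2 fun h => hvc ((hN' 0).2 h)
      · exact Bool.eq_false_iff.2 fun h => hb ((hN' 4).2 h)
    · push Not at hw
      let f : Fin 4 → V := ![c, l, l', b]
      have hf : f.Injective := injective_four (by grind)
      have hfv : ∀ i, f i ≠ v := forall_four_ne (by grind)
      have hcode : G.HasCode f [14, 1, 1, 1] := by
        intro i j
        rw [h _ _ (hfv i) (hfv j), hf.ne_iff, show c = f 0 from rfl, hf.eq_iff, hf.eq_iff]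
        revert i j
        decide
      have hcode' := hcode.extend (N := 6) v (by norm_num) <| by
        intro i
        fin_cases i <;> simp [f, hvc, hl, hl', hb, Nat.testBit, Nat.shiftRight_eq_div_pow]
      refine hcode'.hasConnectedForm_of_path (snoc_bijective hf hfv fun w hwv => ?_)
        transforms_star_three_extend
      by_contra hne
      push Not at hne
      exact hne 3 (hw w hwv (hne 0).symm (hne 1).symm (hne 2).symm).symm
  · push Not at hB
    -- Every leaf is adjacent to `v`: the three local complementations perform a pivot.
    have key : ∀ b, G.Adj v b ↔ b ≠ v ∧ b ≠ c := fun b =>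
      ⟨fun hb => ⟨hb.ne', by rintro rfl; exact hvc hb⟩, fun hb => hB b hb.1 hb.2⟩
    have hadj : ∀ a b, G.Adj a b ↔ a ≠ b ∧ ((a = c ∧ b ≠ v) ∨ (b = c ∧ a ≠ v) ∨
        (a = v ∧ b ≠ c) ∨ (b = v ∧ a ≠ c)) := by
      intro a b
      rw [hadj, key, key]
      grind
    have h1 : ∀ a b, (G.localComplement c).Adj a b ↔ a ≠ b ∧
        ¬ (a = c ∧ b = v) ∧ ¬ (a = v ∧ b = c) := by
      intro a b
      rw [localComplement_adj, hadj, hadj, hadj]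
      grind
    have h2 : ∀ a b, ((G.localComplement c).localComplement l).Adj a b ↔ a ≠ b ∧
        ((a = l ∨ b = l) ∨ (a = c ∧ b = v) ∨ (a = v ∧ b = c)) := by
      intro a b
      rw [localComplement_adj, h1, h1, h1]
      grind
    refine HasConnectedForm.of_locallyEquivalent
      ((((LocallyEquivalent.refl G).localComplement c).localComplement l).localComplement c)
      (IsSubdividedStar.hasConnectedForm ⟨l, c, v, hlc, hlv, hcv, ?_⟩)
    intro a b
    rw [localComplement_adj, h2, h2, h2]
    grind

/-- Adding a vertex `v` to a star with a subdivided edge. -/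
theorem hasConnectedForm_of_subdividedStar [Fintype V] {G : SimpleGraph V} {v c x y : V}
    (hcv : c ≠ v) (hxv : x ≠ v) (hyv : y ≠ v) (hcx : c ≠ x) (hcy : c ≠ y) (hxy : x ≠ y)
    (h : ∀ a b, a ≠ v → b ≠ v → (G.Adj a b ↔ a ≠ b ∧
      ((a = c ∧ b ≠ y) ∨ (b = c ∧ a ≠ y) ∨ (a = x ∧ b = y) ∨ (a = y ∧ b = x))))
    (hv : ∃ w, G.Adj v w) (havg : G.averageCutRank ≤ 3 / 2) : G.HasConnectedForm := by
  by_cases hl : ∃ l, l ≠ v ∧ l ≠ c ∧ l ≠ x ∧ l ≠ y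
  swap
  · push Not at hl
    -- Without further leaves, G-v is the path `c`, `x`, `y`, a star with centre `x`.
    refine hasConnectedForm_of_star hxv (fun a b ha hb => ?_) hv havg
    rw [h a b ha hb]
    have := hl a ha
    have := hl b hb
    grind
  -- Two further leaves make E_2 an induced subgraph, and then `v` can see neither `x`, `y` nor a
  -- leaf; it is a new leaf at `c`.
  have five : ∀ l₁ l₂ : V, l₁ ≠ l₂ → (l₁ ≠ v ∧ l₁ ≠ c ∧ l₁ ≠ x ∧ l₁ ≠ y) →
      (l₂ ≠ v ∧ l₂ ≠ c ∧ l₂ ≠ x ∧ l₂ ≠ y) → (G.Adj v x ∨ G.Adj v y ∨ G.Adj v l₁) → False := by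
    rintro l₁ l₂ hne ⟨h1v, h1c, h1x, h1y⟩ ⟨h2v, h2c, h2x, h2y⟩ hw
    let f : Fin 5 → V := ![c, l₁, l₂, x, y]
    have hf : f.Injective := injective_five (by grind)
    have hfv : ∀ i, f i ≠ v := forall_five_ne (by grind)
    have hcode : G.HasCode f [14, 1, 1, 17, 8] := by
      intro i j
      rw [h _ _ (hfv i) (hfv j), show c = f 0 from rfl, show x = f 3 from rfl,
        show y = f 4 from rfl]
      simp only [hf.eq_iff, ne_eq]
      revert i j
      decide
    obtain ⟨N, hN, hN'⟩ := exists_bits fun i => G.Adj v (f i)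
    have hbit : N.testBit 3 = true ∨ N.testBit 4 = true ∨ N.testBit 1 = true := by
      rcases hw with hw | hw | hw
      · exact Or.inl ((hN' 3).1 hw)
      · exact Or.inr (Or.inl ((hN' 4).1 hw))
      · exact Or.inr (Or.inr ((hN' 1).1 hw))
    refine absurd havg (not_le.2 (hcode.lt_averageCutRank_extend hf hfv hN hN'
      (cutRankSum_subdividedStar_extend N hN ?_ ?_)))
    · rintro rfl; revert hbit; decide
    · rintro rfl; revert hbit; decide
  obtain ⟨l, hlv, hlc, hlx, hly⟩ := hl
  by_cases hl' : ∃ l', l' ≠ l ∧ l' ≠ v ∧ l' ≠ c ∧ l' ≠ x ∧ l' ≠ y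
  · obtain ⟨l', hl'⟩ := hl'
    have hx : ¬ G.Adj v x := fun hw => five l l' hl'.1.symm ⟨hlv, hlc, hlx, hly⟩ hl'.2 (Or.inl hw)
    have hy : ¬ G.Adj v y := fun hw =>
      five l l' hl'.1.symm ⟨hlv, hlc, hlx, hly⟩ hl'.2 (Or.inr (Or.inl hw))
    have key : ∀ b, G.Adj v b → b = c := by
      intro b hb
      by_contra hbc
      have hb' : b ≠ v ∧ b ≠ c ∧ b ≠ x ∧ b ≠ y :=
        ⟨hb.ne', hbc, by rintro rfl; exact hx hb, by rintro rfl; exact hy hb⟩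
      by_cases hbl : b = l
      · exact five b l' (hbl ▸ hl'.1.symm) hb' hl'.2 (Or.inr (Or.inr hb))
      · exact five b l hbl hb' ⟨hlv, hlc, hlx, hly⟩ (Or.inr (Or.inr hb))
    have hvc : G.Adj v c := by
      obtain ⟨w, hw⟩ := hv
      exact key w hw ▸ hw
    refine IsSubdividedStar.hasConnectedForm ⟨c, x, y, hcx, hcy, hxy, fun a b => ?_⟩
    have key' : ∀ b, G.Adj v b ↔ b = c := fun b => ⟨key b, fun hb => hb ▸ hvc⟩
    by_cases ha : a = v
    · subst ha
      rw [key']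
      grind
    · by_cases hb : b = v
      · subst hb
        rw [G.adj_comm, key']
        grind
      · exact h a b ha hb
  · push Not at hl'
    -- With a single further leaf, G-v is the four-vertex path `l`, `c`, `x`, `y`.
    let f : Fin 4 → V := ![c, l, x, y]
    have hf : f.Injective := injective_four (by grind)
    have hfv : ∀ i, f i ≠ v := forall_four_ne (by grind)
    have hcode : G.HasCode f [6, 1, 9, 4] := by
      intro i j
      rw [h _ _ (hfv i) (hfv j), show c = f 0 from rfl, show x = f 2 from rfl,
        show y = f 3 from rfl]
      simp only [hf.eq_iff, ne_eq]
      revert i j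
      decide
    have hsurj : ∀ w, w ≠ v → ∃ i, f i = w := by
      intro w hw
      by_contra hne
      push Not at hne
      exact hne 3 (hl' w (hne 1).symm hw (hne 0).symm (hne 2).symm).symm
    obtain ⟨N, hN, hN'⟩ := exists_bits fun i => G.Adj v (f i)
    have hbij := snoc_bijective hf hfv hsurj
    have hcode' := hcode.extend v hN hN'
    have hN0 : N ≠ 0 := by
      rintro rfl
      obtain ⟨w, hw⟩ := hv
      obtain ⟨i, rfl⟩ := hsurj w hw.ne'
      have := (hN' i).1 hw
      simp at this
    rcases path_four_extend N hN hN0 with hbad | ⟨p, -, hp⟩ | ⟨p, -, hp⟩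
    · exact absurd havg (not_le.2 (hcode.lt_averageCutRank_extend hf hfv hN hN' hbad))
    · exact hcode'.hasConnectedForm_of_subdividedStar hbij hp
    · exact hcode'.hasConnectedForm_of_path hbij hp

/-- No vertex can be added to a path on five vertices. -/
theorem lt_averageCutRank_of_path [Fintype V] {G : SimpleGraph V} {v : V}
    (e : G.induce {v}ᶜ ≃g pathGraph 5) (hv : ∃ w, G.Adj v w) : 3 / 2 < G.averageCutRank := by
  let f : Fin 5 → V := fun i => (e.symm i).val
  have hf : f.Injective := Subtype.val_injective.comp e.symm.injective
  have hfv : ∀ i, f i ≠ v := fun i => (e.symm i).2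
  have hcode : G.HasCode f [2, 5, 10, 20, 8] := fun i j =>
    (e.symm.map_adj_iff).trans (pathGraph_five_hasCode i j)
  obtain ⟨N, hN, hN'⟩ := exists_bits fun i => G.Adj v (f i)
  refine hcode.lt_averageCutRank_extend hf hfv hN hN' (cutRankSum_path_extend N hN ?_)
  rintro rfl
  obtain ⟨w, hw⟩ := hv
  have := (hN' (e ⟨w, hw.ne'⟩)).1 (by simpa [f] using hw)
  simp at this

/-- Induction on the order: remove a vertex whose deletion keeps the graph connected, normalise the
rest, and lift the local complementations. They create no isolated vertex, so the removed vertex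
keeps a neighbour. -/
theorem Connected.hasConnectedForm [Fintype V] {G : SimpleGraph V} (hG : G.Connected)
    (havg : G.averageCutRank ≤ 3 / 2) : G.HasConnectedForm := by
  classical
  induction hn : Fintype.card V using Nat.strong_induction_on generalizing V with
  | _ n ih =>
  rcases subsingleton_or_nontrivial V with hV | hV
  · obtain ⟨c⟩ := hG.nonempty
    refine IsStar.hasConnectedForm ⟨c, fun a b => ?_⟩
    obtain rfl := Subsingleton.elim a b
    simp
  obtain ⟨v, hv⟩ := hG.exists_connected_induce_compl_singleton_of_finite_nontrivial
  have hlt : Fintype.card ({v}ᶜ : Set V) < n := by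
    rw [← hn]
    exact Fintype.card_subtype_lt (x := v) (by simp)
  obtain ⟨K, hK, hform⟩ := ih _ hlt hv
    ((averageCutRank_le_of_embedding (Embedding.induce _)).trans havg) rfl
  obtain ⟨G', hG', rfl⟩ := hK.exists_of_induce
  have havg' : G'.averageCutRank ≤ 3 / 2 := by rwa [hG'.averageCutRank_eq]
  have hadj : ∃ w, G'.Adj v w := by
    have hiso : ¬ G'.IsIsolated v := by
      rw [hG'.isIsolated_iff]
      intro h
      obtain ⟨w, hw⟩ := hG.preconnected.exists_adj_of_nontrivial v
      exact h w hw
    simpa [IsIsolated] using hiso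
  refine HasConnectedForm.of_locallyEquivalent hG' ?_
  rcases hform with ⟨c, hc⟩ | ⟨c, x, y, hcx, hcy, hxy, h⟩ | ⟨⟨e⟩⟩
  · refine hasConnectedForm_of_star c.2 (fun a b ha hb => ?_) hadj havg'
    simpa [Subtype.ext_iff] using hc ⟨a, ha⟩ ⟨b, hb⟩
  · refine hasConnectedForm_of_subdividedStar c.2 x.2 y.2 (Subtype.coe_ne_coe.2 hcx)
      (Subtype.coe_ne_coe.2 hcy) (Subtype.coe_ne_coe.2 hxy) (fun a b ha hb => ?_) hadj havg'
    simpa [Subtype.ext_iff] using h ⟨a, ha⟩ ⟨b, hb⟩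
  · exact absurd havg' (not_le.2 (lt_averageCutRank_of_path e hadj))

end SimpleGraph

/-! ### Average cut-ranks of the listed graphs. -/

namespace SimpleGraph

universe u₁

variable {V : Type u₁}

theorem IsStar.nonempty_iso [Fintype V] {G : SimpleGraph V} (hG : G.IsStar) :
    ∃ n, Fintype.card V = n + 1 ∧ Nonempty (G ≃g starK n) := by
  classical
  obtain ⟨c, hc⟩ := hG
  let e := (Fintype.equivFin {w // w ≠ c}).symm
  let f : Fin 1 ⊕ Fin (Fintype.card {w // w ≠ c}) → V := Sum.elim (fun _ => c) fun i => (e i).val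
  have hf : f.Bijective := by
    refine ⟨?_, fun w => ?_⟩
    · rintro (i | i) (j | j) h
      · rw [Subsingleton.elim i j]
      · exact absurd h.symm (e j).2
      · exact absurd h (e i).2
      · exact congrArg _ (e.injective (Subtype.ext h))
    · by_cases hw : w = c
      · exact ⟨Sum.inl 0, hw.symm⟩
      · exact ⟨Sum.inr (e.symm ⟨w, hw⟩), by simp [f]⟩
  refine ⟨_, ?_, ⟨Iso.symm ⟨Equiv.ofBijective f hf, fun {a b} => ?_⟩⟩⟩
  · rw [← Fintype.card_of_bijective hf, Fintype.card_sum, Fintype.card_fin, Fintype.card_fin,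
      add_comm]
  · rw [Equiv.ofBijective_apply, Equiv.ofBijective_apply, hc, hf.1.ne_iff]
    rcases a with a | a <;> rcases b with b | b
    · simp [Subsingleton.elim a b]
    · simp [f]
    · simp [f]
    · have := (e a).2
      have := (e b).2
      simp_all [f]

theorem IsSubdividedStar.nonempty_iso [Fintype V] {G : SimpleGraph V} (hG : G.IsSubdividedStar) :
    ∃ k, Nonempty (G ≃g graphE k) := by
  classical
  obtain ⟨c, x, y, hcx, hcy, hxy, h⟩ := hG
  let e := (Fintype.equivFin {w // w ≠ c ∧ w ≠ x ∧ w ≠ y}).symm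
  let f : Option (Fin 1 ⊕ Fin (Fintype.card {w // w ≠ c ∧ w ≠ x ∧ w ≠ y} + 1)) → V
    | none => x
    | some (Sum.inl _) => c
    | some (Sum.inr i) => Fin.cases y (fun i => (e i).val) i
  have f0 : f none = x := rfl
  have f1 : ∀ i, f (some (Sum.inl i)) = c := fun _ => rfl
  have f2 : f (some (Sum.inr 0)) = y := rfl
  have f3 : ∀ i : Fin _, f (some (Sum.inr i.succ)) = (e i).val := fun _ => rfl
  have he : ∀ i, (e i).val ≠ c ∧ (e i).val ≠ x ∧ (e i).val ≠ y := fun i => (e i).2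
  have he' : ∀ i j, (e i).val = (e j).val ↔ i = j := fun i j =>
    ⟨fun h => e.injective (Subtype.ext h), fun h => h ▸ rfl⟩
  have hf : f.Bijective := by
    refine ⟨?_, fun w => ?_⟩
    · rintro (_ | i | i) (_ | j | j) hij <;> try cases i using Fin.cases
      all_goals try cases j using Fin.cases
      all_goals simp only [f0, f1, f2, f3, he'] at hij
      all_goals grind
    · by_cases hwc : w = c
      · exact ⟨some (Sum.inl 0), hwc.symm⟩
      by_cases hwx : w = x
      · exact ⟨none, hwx.symm⟩
      by_cases hwy : w = y
      · exact ⟨some (Sum.inr 0), hwy.symm⟩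
      exact ⟨some (Sum.inr (e.symm ⟨w, hwc, hwx, hwy⟩).succ), by simp [f3]⟩
  refine ⟨_, ⟨Iso.symm ⟨Equiv.ofBijective f hf, fun {a b} => ?_⟩⟩⟩
  rw [Equiv.ofBijective_apply, Equiv.ofBijective_apply, h, hf.1.ne_iff]
  rcases a with _ | i | i <;> rcases b with _ | j | j <;> try cases i using Fin.cases
  all_goals try cases j using Fin.cases
  all_goals simp [graphE, subdivideEdge, f0, f1, f2, f3, hcx, hcy, hxy, hcx.symm, hcy.symm,
    hxy.symm, fun i => (he i).1, fun i => (he i).2.1, fun i => (he i).2.2, Fin.fin_one_eq_zero]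

/-- Pendant recursion at a leaf: deleting leaf and centre leaves no edges, so each new leaf halves
the distance to 1. -/
theorem averageCutRank_starK (n : ℕ) : (starK n).averageCutRank = 1 - 1 / 2 ^ n := by
  induction n with
  | zero =>
    have : starK 0 = ⊥ := by
      ext (a | a) (b | b)
      · simp
      · exact b.elim0
      · exact a.elim0
      · exact a.elim0
    rw [this, averageCutRank_bot]
    norm_num
  | succ n ih =>
    let f : Option (Option (Fin n)) → Fin 1 ⊕ Fin (n + 1)
      | none => Sum.inr 0
      | some none => Sum.inl 0
      | some (some i) => Sum.inr i.succ
    have hf : f.Bijective := by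
      refine ⟨?_, ?_⟩
      · rintro (_ | _ | i) (_ | _ | j) hij <;>
          simp_all [f, Fin.succ_ne_zero, (Fin.succ_ne_zero _).symm]
      · rintro (i | i)
        · exact ⟨some none, by simp [f, Subsingleton.elim i 0]⟩
        · cases i using Fin.cases with
          | zero => exact ⟨none, rfl⟩
          | succ i => exact ⟨some (some i), rfl⟩
    rw [← averageCutRank_eq_of_iso (Iso.comap (Equiv.ofBijective f hf) (starK (n + 1))),
      averageCutRank_pendant]
    · have h1 : (((starK (n + 1)).comap (Equiv.ofBijective f hf)).comap some).IsStar := by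
        refine ⟨none, ?_⟩
        rintro (_ | a) (_ | b) <;> simp [f]
      obtain ⟨m, hm, ⟨e⟩⟩ := h1.nonempty_iso
      obtain rfl : n = m := by simpa using hm
      have h2 : ((starK (n + 1)).comap (Equiv.ofBijective f hf)).comap
          (fun w : Fin n => some (some w)) = ⊥ := by
        ext a b
        simp [f]
      rw [h2, averageCutRank_bot, averageCutRank_eq_of_iso e, ih, pow_succ]
      field_simp
      ring
    · rintro (_ | _ | x) <;> simp [f]

theorem IsStar.averageCutRank_eq [Fintype V] {G : SimpleGraph V} (hG : G.IsStar) {n : ℕ}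
    (hn : Fintype.card V = n + 1) : G.averageCutRank = 1 - 1 / 2 ^ n := by
  obtain ⟨m, hm, ⟨e⟩⟩ := hG.nonempty_iso
  obtain rfl : n = m := by omega
  rw [averageCutRank_eq_of_iso e, averageCutRank_starK]

/-- Pendant recursion at the far end of the subdivided edge: deleting it leaves K_{1,k+1}, and
deleting also the subdividing vertex leaves K_{1,k}. -/
theorem averageCutRank_graphE (k : ℕ) : (graphE k).averageCutRank = 3 / 2 - 3 / 2 ^ (k + 2) := by
  let f : Option (Option (Fin 1 ⊕ Fin k)) → Option (Fin 1 ⊕ Fin (k + 1))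
    | none => some (Sum.inr 0)
    | some none => none
    | some (some (Sum.inl _)) => some (Sum.inl 0)
    | some (some (Sum.inr i)) => some (Sum.inr i.succ)
  have hf : f.Bijective := by
    refine ⟨?_, ?_⟩
    · rintro (_ | _ | i | i) (_ | _ | j | j) hij <;>
        simp_all [f, Fin.succ_ne_zero, (Fin.succ_ne_zero _).symm, Fin.fin_one_eq_zero]
    · rintro (_ | i | i)
      · exact ⟨some none, rfl⟩
      · exact ⟨some (some (Sum.inl 0)), by simp [f, Subsingleton.elim i 0]⟩
      · cases i using Fin.cases with
        | zero => exact ⟨none, rfl⟩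
        | succ i => exact ⟨some (some (Sum.inr i)), rfl⟩
  rw [← averageCutRank_eq_of_iso (Iso.comap (Equiv.ofBijective f hf) (graphE k)),
    averageCutRank_pendant]
  · have h1 : (((graphE k).comap (Equiv.ofBijective f hf)).comap some).IsStar := by
      refine ⟨some (Sum.inl 0), ?_⟩
      rintro (_ | a | a) (_ | b | b) <;>
        simp [f, graphE, subdivideEdge, Fin.fin_one_eq_zero]
    have h2 : (((graphE k).comap (Equiv.ofBijective f hf)).comap
        (fun w : Fin 1 ⊕ Fin k => some (some w))).IsStar := by
      refine ⟨Sum.inl 0, ?_⟩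
      rintro (a | a) (b | b) <;>
        simp [f, graphE, subdivideEdge, Fin.fin_one_eq_zero]
    rw [h1.averageCutRank_eq (n := k + 1) (by simp [add_comm]),
      h2.averageCutRank_eq (n := k) (by simp [add_comm])]
    field_simp
    ring
  · rintro (_ | _ | x | x) <;> simp [f, graphE, subdivideEdge]

/-- The value 46/32, written as the member `k = 3` of the second family. -/
theorem averageCutRank_pathGraph_five : (pathGraph 5).averageCutRank = 3 / 2 - 1 / 2 ^ (3 + 1) := by
  rw [pathGraph_five_hasCode.averageCutRank_eq, cutRankSum_path_eq]
  norm_num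

theorem completeGraph_two_isStar : (completeGraph (Fin 2)).IsStar :=
  ⟨0, by simp only [completeGraph, top_adj]; decide⟩

theorem pathGraph_three_isStar : (pathGraph 3).IsStar :=
  ⟨1, by simp only [pathGraph_adj]; decide⟩

/-- E_0 is P_3, so the standard forms can count it among the stars and start from E_1. -/
theorem graphE_zero_isStar : (graphE 0).IsStar := by
  refine ⟨none, ?_⟩
  rintro (_ | a | a) (_ | b | b) <;>
    simp [graphE, subdivideEdge, Fin.fin_one_eq_zero]

/-- Splitting off one copy. -/
def copiesSuccIso (m : ℕ) (G : SimpleGraph V) : copies m G ⊕g G ≃g copies (m + 1) G where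
  toFun := Sum.elim (fun p => (p.1.castSucc, p.2)) fun v => (Fin.last m, v)
  invFun p := Fin.lastCases (motive := fun _ => (Fin m × V) ⊕ V) (Sum.inr p.2)
    (fun i => Sum.inl (i, p.2)) p.1
  left_inv := by rintro (⟨i, v⟩ | v) <;> simp
  right_inv := by
    rintro ⟨i, v⟩
    induction i using Fin.lastCases <;> simp
  map_rel_iff' := by
    rintro (⟨i, v⟩ | v) (⟨j, w⟩ | w) <;>
      simp [copies, (Fin.castSucc_lt_last _).ne, (Fin.castSucc_lt_last _).ne']

/-- A single copy of `G` is isomorphic to `G`. -/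
def copiesOneIso (G : SimpleGraph V) : copies 1 G ≃g G where
  toEquiv := Equiv.uniqueProd V (Fin 1)
  map_rel_iff' := by
    rintro ⟨i, v⟩ ⟨j, w⟩
    simp [copies, Subsingleton.elim i j]

theorem averageCutRank_copies_two [Fintype V] (G : SimpleGraph V) :
    (copies 2 G).averageCutRank = 2 * G.averageCutRank := by
  rw [← averageCutRank_eq_of_iso (copiesSuccIso 1 G), averageCutRank_sum,
    averageCutRank_eq_of_iso (copiesOneIso G), two_mul]

theorem averageCutRank_copies_three [Fintype V] (G : SimpleGraph V) :
    (copies 3 G).averageCutRank = 3 * G.averageCutRank := by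
  rw [← averageCutRank_eq_of_iso (copiesSuccIso 2 G), averageCutRank_sum,
    averageCutRank_copies_two]
  ring

theorem averageCutRank_completeGraph_two :
    (completeGraph (Fin 2)).averageCutRank = 1 / 2 := by
  rw [completeGraph_two_isStar.averageCutRank_eq (n := 1) (by simp)]
  norm_num

theorem averageCutRank_pathGraph_three : (pathGraph 3).averageCutRank = 3 / 4 := by
  rw [pathGraph_three_isStar.averageCutRank_eq (n := 2) (by simp)]
  norm_num

theorem averageCutRank_copies_completeGraph :
    (copies 3 (completeGraph (Fin 2))).averageCutRank = 3 / 2 := by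
  rw [averageCutRank_copies_three, averageCutRank_completeGraph_two]
  norm_num

theorem averageCutRank_copies_pathGraph : (copies 2 (pathGraph 3)).averageCutRank = 3 / 2 := by
  rw [averageCutRank_copies_two, averageCutRank_pathGraph_three]
  norm_num

theorem averageCutRank_edge_sum_starK (n : ℕ) :
    (completeGraph (Fin 2) ⊕g starK n).averageCutRank = 3 / 2 - 1 / 2 ^ n := by
  rw [averageCutRank_sum, averageCutRank_completeGraph_two, averageCutRank_starK]
  ring

theorem nonempty_iso_sum_induce {G : SimpleGraph V} {S : Set V}
    (h : ∀ a ∈ S, ∀ b ∉ S, ¬ G.Adj a b) :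
    Nonempty (G.induce S ⊕g G.induce Sᶜ ≃g G) := by
  classical
  refine ⟨⟨Equiv.Set.sumCompl S, ?_⟩⟩
  rintro (a | a) (b | b)
  · simp
  · simpa using h a a.2 b b.2
  · simpa [G.adj_comm] using h b b.2 a a.2
  · simp

end SimpleGraph

/-! ### Standard forms, disjoint unions and isolated vertices. -/

namespace SimpleGraph

universe u₁

variable {V : Type u₁}

/-- The standard forms, up to local equivalence and isomorphism, of the graphs without isolated
vertices of average cut-rank at most `3 / 2`. -/
def HasStandardForm (G : SimpleGraph V) : Prop :=
  (∃ n, G.LocallyEquivalentIso (starK (n + 1))) ∨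
  (∃ n, G.LocallyEquivalentIso (completeGraph (Fin 2) ⊕g starK (n + 1))) ∨
  (∃ k, G.LocallyEquivalentIso (graphE (k + 1))) ∨
  G.LocallyEquivalentIso (pathGraph 5) ∨
  G.LocallyEquivalentIso (copies 3 (completeGraph (Fin 2))) ∨
  G.LocallyEquivalentIso (copies 2 (pathGraph 3))

theorem HasStandardForm.of_iso {W : Type*} {G : SimpleGraph V} {H : SimpleGraph W} (e : G ≃g H)
    (h : H.HasStandardForm) : G.HasStandardForm := by
  rcases h with ⟨n, h⟩ | ⟨n, h⟩ | ⟨n, h⟩ | h | h | h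
  · exact Or.inl ⟨n, h.iso_trans e⟩
  · exact Or.inr (Or.inl ⟨n, h.iso_trans e⟩)
  · exact Or.inr (Or.inr (Or.inl ⟨n, h.iso_trans e⟩))
  · exact Or.inr (Or.inr (Or.inr (Or.inl (h.iso_trans e))))
  · exact Or.inr (Or.inr (Or.inr (Or.inr (Or.inl (h.iso_trans e)))))
  · exact Or.inr (Or.inr (Or.inr (Or.inr (Or.inr (h.iso_trans e)))))

theorem one_div_two_pow_succ_le (n : ℕ) : (1 : ℝ) / 2 ^ (n + 1) ≤ 1 / 2 := by
  rw [pow_succ]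
  have : (1 : ℝ) ≤ 2 ^ n := one_le_pow₀ (by norm_num)
  rw [div_le_div_iff₀ (by positivity) (by norm_num)]
  linarith

/-- The standard forms of average cut-rank at most `1`. -/
theorem HasStandardForm.of_averageCutRank_le_one [Fintype V] {G : SimpleGraph V}
    (h : G.HasStandardForm) (havg : G.averageCutRank ≤ 1) :
    (∃ n, G.LocallyEquivalentIso (starK (n + 1)) ∧ G.averageCutRank = 1 - 1 / 2 ^ (n + 1)) ∨
    (G.LocallyEquivalentIso (completeGraph (Fin 2) ⊕g starK 1) ∧ G.averageCutRank = 1) := by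
  -- Beyond stars and 2K_2 the values exceed 1: at least 5/4 for K_2 plus a larger star, at least
  -- 9/8 for E_{k+1}, and 23/16 or 3/2 for the rest.
  rcases h with ⟨n, h⟩ | ⟨n, h⟩ | ⟨n, h⟩ | h | h | h
  · exact Or.inl ⟨n, h, by rw [h.averageCutRank_eq, averageCutRank_starK]⟩
  · have hval := h.averageCutRank_eq
    rw [averageCutRank_edge_sum_starK] at hval
    rcases n with _ | n
    · exact Or.inr ⟨h, by rw [hval]; norm_num⟩
    · have := one_div_two_pow_succ_le n
      rw [pow_succ _ (n + 1), ← div_div] at hval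
      linarith
  · have hval := h.averageCutRank_eq
    rw [averageCutRank_graphE] at hval
    have h8 : (3 : ℝ) / 2 ^ (n + 1 + 2) = 3 / 4 * (1 / 2 ^ (n + 1)) := by
      rw [pow_add _ (n + 1)]
      field_simp
      norm_num
    have := one_div_two_pow_succ_le n
    linarith
  · have := h.averageCutRank_eq
    rw [averageCutRank_pathGraph_five] at this
    norm_num at this
    linarith
  · have := h.averageCutRank_eq
    rw [averageCutRank_copies_completeGraph] at this
    linarith
  · have := h.averageCutRank_eq
    rw [averageCutRank_copies_pathGraph] at this
    linarith

theorem nonempty_starK_one_iso : Nonempty (starK 1 ≃g completeGraph (Fin 2)) := by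
  obtain ⟨n, hn, ⟨e⟩⟩ := completeGraph_two_isStar.nonempty_iso
  obtain rfl : n = 1 := by simpa using hn
  exact ⟨e.symm⟩

theorem nonempty_starK_two_iso : Nonempty (starK 2 ≃g pathGraph 3) := by
  obtain ⟨n, hn, ⟨e⟩⟩ := pathGraph_three_isStar.nonempty_iso
  obtain rfl : n = 2 := by simpa using hn
  exact ⟨e.symm⟩

/-- The disjoint union of two graphs in standard form. -/
theorem HasStandardForm.sum {V W : Type*} [Fintype V] [Fintype W] {G : SimpleGraph V}
    {H : SimpleGraph W} (hG : G.HasStandardForm) (hH : H.HasStandardForm)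
    (hle : G.averageCutRank ≤ H.averageCutRank)
    (havg : G.averageCutRank + H.averageCutRank ≤ 3 / 2) : (G ⊕g H).HasStandardForm := by
  obtain ⟨eK⟩ := nonempty_starK_one_iso
  obtain ⟨eP⟩ := nonempty_starK_two_iso
  -- The smaller part has value at most 3/4, so it is K_2 or P_3. With P_3 the other part must also
  -- be worth exactly 3/4; with K_2 it is a star or 2K_2.
  rcases hG.of_averageCutRank_le_one (by linarith) with ⟨n, hG, hGval⟩ | ⟨-, hGval⟩
  swap
  · linarith
  have hn := one_div_two_pow_succ_le n
  rcases hH.of_averageCutRank_le_one (by linarith) with ⟨m, hH, hHval⟩ | ⟨hH, hHval⟩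
  · rcases n with _ | _ | n
    · exact Or.inr (Or.inl ⟨m, (hG.trans_iso eK).sum hH⟩)
    · rcases m with _ | _ | m
      · norm_num at hGval hHval
        linarith
      · exact Or.inr (Or.inr (Or.inr (Or.inr (Or.inr
          (((hG.trans_iso eP).sum (hH.trans_iso eP)).trans_iso
            ((Iso.sumCongr (copiesOneIso _).symm (Iso.refl)).trans (copiesSuccIso 1 _)))))))
      · exfalso
        have := one_div_two_pow_succ_le m
        rw [pow_succ _ (m + 1 + 1), pow_succ _ (m + 1), ← div_div, ← div_div] at hHval
        norm_num at hGval
        linarith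
    · exfalso
      have := one_div_two_pow_succ_le n
      rw [pow_succ _ (n + 1 + 1), pow_succ _ (n + 1), ← div_div, ← div_div] at hGval
      linarith
  · rcases n with _ | n
    · have h2 := (hG.trans_iso eK).sum hH
      refine Or.inr (Or.inr (Or.inr (Or.inr (Or.inl (h2.trans_iso ?_)))))
      refine (Iso.sumCongr Iso.refl (Iso.sumCongr (copiesOneIso _).symm eK)).trans ?_
      exact (Iso.sumCongr Iso.refl (copiesSuccIso 1 _)).trans
        (Iso.sumComm.trans (copiesSuccIso 2 _))
    · exfalso
      have := one_div_two_pow_succ_le n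
      rw [pow_succ _ (n + 1), ← div_div] at hGval
      linarith

/-- Strong induction on the order: a connected graph is covered by its connected form, and otherwise
a component splits off, neither side having isolated vertices. The empty graph is a separate
outcome. -/
theorem isEmpty_or_hasStandardForm [Fintype V] {G : SimpleGraph V} (hG : ∀ v, ¬ G.IsIsolated v)
    (havg : G.averageCutRank ≤ 3 / 2) : IsEmpty V ∨ G.HasStandardForm := by
  classical
  induction hn : Fintype.card V using Nat.strong_induction_on generalizing V with
  | _ n ih =>
  rcases isEmpty_or_nonempty V with hV | ⟨⟨v⟩⟩
  · exact Or.inl hV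
  right
  by_cases hconn : ∀ w, G.Reachable v w
  · have hc : G.Connected :=
      { preconnected := fun a b => (hconn a).symm.trans (hconn b)
        nonempty := ⟨v⟩ }
    obtain ⟨G', hG', h⟩ := hc.hasConnectedForm havg
    have star : ∀ {m}, (G' ≃g starK m) → G.HasStandardForm := by
      intro m e
      -- A star without leaves is a single isolated vertex.
      rcases m with _ | m
      · exfalso
        apply hG v
        rw [← hG'.isIsolated_iff]
        intro w hw
        rw [← e.map_adj_iff] at hw
        have key : ∀ a : Fin 1 ⊕ Fin 0, a = Sum.inl 0 := by
          rintro (a | a)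
          · rw [Subsingleton.elim a 0]
          · exact a.elim0
        rw [key (e v), key (e w)] at hw
        exact hw.ne rfl
      · exact Or.inl ⟨m, G', hG', ⟨e⟩⟩
    rcases h with h | h | h
    · obtain ⟨m, -, ⟨e⟩⟩ := h.nonempty_iso
      exact star e
    · obtain ⟨k, ⟨e⟩⟩ := h.nonempty_iso
      rcases k with _ | k
      · obtain ⟨m, -, ⟨e'⟩⟩ := graphE_zero_isStar.nonempty_iso
        exact star (e.trans e')
      · exact Or.inr (Or.inr (Or.inl ⟨k, G', hG', ⟨e⟩⟩))
    · exact Or.inr (Or.inr (Or.inr (Or.inl ⟨G', hG', h⟩)))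
  · push Not at hconn
    obtain ⟨w, hw⟩ := hconn
    let S : Set V := {x | G.Reachable v x}
    have hcross : ∀ a ∈ S, ∀ b ∉ S, ¬ G.Adj a b := fun a ha b hb hab =>
      hb (Reachable.trans ha hab.reachable)
    obtain ⟨e⟩ := nonempty_iso_sum_induce hcross
    have hsum := averageCutRank_eq_of_iso e
    rw [averageCutRank_sum] at hsum
    have h1 := averageCutRank_nonneg (G.induce S)
    have h2 := averageCutRank_nonneg (G.induce Sᶜ)
    have i1 : ∀ x, ¬ (G.induce S).IsIsolated x := by
      intro x hx
      refine hG x fun y hy => ?_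
      by_cases hyS : y ∈ S
      · exact hx ⟨y, hyS⟩ hy
      · exact hcross x x.2 y hyS hy
    have i2 : ∀ x, ¬ (G.induce Sᶜ).IsIsolated x := by
      intro x hx
      refine hG x fun y hy => ?_
      by_cases hyS : y ∈ S
      · exact hcross y hyS x x.2 hy.symm
      · exact hx ⟨y, hyS⟩ hy
    have hvS : v ∈ S := Reachable.refl v
    have f1 : (G.induce S).HasStandardForm :=
      (ih _ (hn ▸ Fintype.card_subtype_lt (x := w) hw) i1 (by linarith) rfl).resolve_left
        fun h => h.elim ⟨v, hvS⟩
    have f2 : (G.induce Sᶜ).HasStandardForm :=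
      (ih _ (hn ▸ Fintype.card_subtype_lt (x := v) (fun h => h hvS)) i2 (by linarith)
        rfl).resolve_left fun h => h.elim ⟨w, hw⟩
    rcases le_total (G.induce S).averageCutRank (G.induce Sᶜ).averageCutRank with hle | hle
    · exact (f1.sum f2 hle (by linarith)).of_iso e.symm
    · exact (f2.sum f1 hle (by linarith)).of_iso (e.symm.trans Iso.sumComm)

/-- Isolated vertices do not contribute to the average cut-rank. -/
theorem exists_induce_averageCutRank_eq [Fintype V] (G : SimpleGraph V) :
    ∃ S : Set V, (∀ x, ¬ (G.induce S).IsIsolated x) ∧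
      ∀ _ : Fintype S, (G.induce S).averageCutRank = G.averageCutRank := by
  classical
  have hcross : ∀ a ∈ {x | ¬ G.IsIsolated x}, ∀ b ∉ {x | ¬ G.IsIsolated x}, ¬ G.Adj a b := by
    intro a _ b hb hab
    exact not_not.1 hb a hab.symm
  refine ⟨{x | ¬ G.IsIsolated x}, ?_, fun _ => ?_⟩
  · intro x hx
    refine x.2 fun y hy => ?_
    by_cases hyS : y ∈ {x | ¬ G.IsIsolated x}
    · exact hx ⟨y, hyS⟩ hy
    · exact hcross x x.2 y hyS hy
  · obtain ⟨e⟩ := nonempty_iso_sum_induce hcross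
    have hbot : G.induce {x | ¬ G.IsIsolated x}ᶜ = ⊥ := by
      ext a b
      have ha : G.IsIsolated a.val := not_not.1 a.2
      simpa using ha b
    rw [← averageCutRank_eq_of_iso e, averageCutRank_sum, hbot, averageCutRank_bot, add_zero]

/-- The extremal graphs live in `Type`; lifting moves them to the universe of the theorem. -/
theorem exists_averageCutRank_eq {W : Type} [Fintype W] (H : SimpleGraph W) :
    ∃ (V : Type u) (_ : Fintype V) (G : SimpleGraph V), G.averageCutRank = H.averageCutRank :=
  ⟨ULift.{u} W, inferInstance, H.comap ULift.down,
    averageCutRank_eq_of_iso (Iso.comap Equiv.ulift H)⟩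

end SimpleGraph

/-! ### The theorem. -/

open SimpleGraph in
theorem theorem1p5 :
    (∀ (V : Type u) [Fintype V] (G : SimpleGraph V), (∀ v, ¬ G.IsIsolated v) →
      (G.averageCutRank ≤ 3 / 2 ↔
        G.IsoToVertexMinor (SimpleGraph.pathGraph 5) ∨
        G.IsoToVertexMinor (SimpleGraph.copies 3 (SimpleGraph.completeGraph (Fin 2))) ∨
        G.IsoToVertexMinor (SimpleGraph.copies 2 (SimpleGraph.pathGraph 3)) ∨
        (∃ k : ℕ, G.IsoToVertexMinor (SimpleGraph.starK (k + 1))) ∨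
        (∃ k : ℕ, G.IsoToVertexMinor
          (SimpleGraph.completeGraph (Fin 2) ⊕g SimpleGraph.starK (k + 1))) ∨
        (∃ k : ℕ, G.IsoToVertexMinor (SimpleGraph.graphE k)))) ∧
    {α : ℝ | (∃ (V : Type u) (_ : Fintype V) (G : SimpleGraph V), G.averageCutRank = α) ∧
        α ∈ Set.Icc 0 (3 / 2)} =
      {α : ℝ | ∃ k : ℕ, α = 1 - 1 / 2 ^ k} ∪
      {α : ℝ | ∃ k : ℕ, α = 3 / 2 - 1 / 2 ^ (k + 1)} ∪
      {α : ℝ | ∃ k : ℕ, α = 3 / 2 - 3 / 2 ^ (k + 2)} ∪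
      {3 / 2} := by
  have hpow : ∀ k : ℕ, (0 : ℝ) < 1 / 2 ^ k := fun k => by positivity
  have hpow' : ∀ k : ℕ, (0 : ℝ) < 3 / 2 ^ k := fun k => by positivity
  refine ⟨fun V _ G hG => ⟨fun havg => ?_, ?_⟩, Set.ext fun α => ⟨?_, ?_⟩⟩
  · rcases isEmpty_or_hasStandardForm hG havg with hV | ⟨k, h⟩ | ⟨k, h⟩ | ⟨k, h⟩ | h | h | h
    -- The empty graph is induced on the empty subset of P_5.
    · exact Or.inl ⟨_, LocallyEquivalent.refl _, ∅,
        ⟨⟨Equiv.equivOfIsEmpty V _, fun {a} => isEmptyElim a⟩⟩⟩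
    · exact Or.inr (Or.inr (Or.inr (Or.inl ⟨k, h.isoToVertexMinor⟩)))
    · exact Or.inr (Or.inr (Or.inr (Or.inr (Or.inl ⟨k, h.isoToVertexMinor⟩))))
    · exact Or.inr (Or.inr (Or.inr (Or.inr (Or.inr ⟨k + 1, h.isoToVertexMinor⟩))))
    · exact Or.inl h.isoToVertexMinor
    · exact Or.inr (Or.inl h.isoToVertexMinor)
    · exact Or.inr (Or.inr (Or.inl h.isoToVertexMinor))
  · classical
    rintro (h | h | h | ⟨k, h⟩ | ⟨k, h⟩ | ⟨k, h⟩) <;> refine h.averageCutRank_le.trans ?_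
    · rw [averageCutRank_pathGraph_five]
      linarith [hpow (3 + 1)]
    · exact averageCutRank_copies_completeGraph.le
    · exact averageCutRank_copies_pathGraph.le
    · rw [averageCutRank_starK]
      linarith [hpow (k + 1)]
    · rw [averageCutRank_edge_sum_starK]
      linarith [hpow (k + 1)]
    · rw [averageCutRank_graphE]
      linarith [hpow' (k + 2)]
  · classical
    rintro ⟨⟨V, _, G, rfl⟩, -, havg⟩
    obtain ⟨S, hS, hval⟩ := exists_induce_averageCutRank_eq G
    rw [← hval inferInstance] at havg ⊢
    rcases isEmpty_or_hasStandardForm hS havg with hV | ⟨k, h⟩ | ⟨k, h⟩ | ⟨k, h⟩ | h | h | h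
    -- All vertices of `G` are isolated, so the value is 0 = 1 - 1/2^0.
    · refine Or.inl (Or.inl (Or.inl ⟨0, ?_⟩))
      rw [Subsingleton.elim (G.induce S) ⊥, averageCutRank_bot]
      norm_num
    · exact Or.inl (Or.inl (Or.inl ⟨k + 1, by rw [h.averageCutRank_eq, averageCutRank_starK]⟩))
    · exact Or.inl (Or.inl (Or.inr ⟨k, by
        rw [h.averageCutRank_eq, averageCutRank_edge_sum_starK]⟩))
    · exact Or.inl (Or.inr ⟨k + 1, by rw [h.averageCutRank_eq, averageCutRank_graphE]⟩)
    · exact Or.inl (Or.inl (Or.inr ⟨3, by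
        rw [h.averageCutRank_eq, averageCutRank_pathGraph_five]⟩))
    · exact Or.inr (by rw [h.averageCutRank_eq, averageCutRank_copies_completeGraph]; rfl)
    · exact Or.inr (by rw [h.averageCutRank_eq, averageCutRank_copies_pathGraph]; rfl)
  · suffices h : ∀ {W : Type} [Fintype W] (H : SimpleGraph W), H.averageCutRank = α →
        α ≤ 3 / 2 → α ∈ {α : ℝ | (∃ (V : Type u) (_ : Fintype V) (G : SimpleGraph V),
          G.averageCutRank = α) ∧ α ∈ Set.Icc 0 (3 / 2)} by
      rintro (((⟨k, hk⟩ | ⟨k, hk⟩) | ⟨k, hk⟩) | hk)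
      · exact h _ ((averageCutRank_starK k).trans hk.symm) (by linarith [hpow k])
      · exact h _ ((averageCutRank_edge_sum_starK (k + 1)).trans hk.symm)
          (by linarith [hpow (k + 1)])
      · exact h _ ((averageCutRank_graphE k).trans hk.symm) (by linarith [hpow' (k + 2)])
      · have hk : α = 3 / 2 := hk
        classical
        exact h _ (averageCutRank_copies_completeGraph.trans hk.symm) hk.le
    intro W _ H hH hle
    obtain ⟨V, hV, G, hG⟩ := exists_averageCutRank_eq.{u} H
    exact ⟨⟨V, hV, G, hG.trans hH⟩, hH ▸ averageCutRank_nonneg H, hle⟩
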